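/- **Setting.** Let $N\ge2$, $n\ge1$, $m\ge2$, $t_0\in\mathbb R$, $T>0$ and $\mu(t)=1/(T+t_0-t)$ for $t\in[t_0,t_0+T)$. A function $\alpha:[0,\infty)\to[0,\infty)$ is of class $\mathcal K_\infty$ if it is continuous, strictly increasing, unbounded and $\alpha(0)=0$. Let $A=[a_{ij}]$ be the weighted adjacency matrix (nonnegative, symmetric, zero diagonal) of a connected undirected graph on $N$ nodes, and let $\lambda_2$ be the second smallest eigenvalue of its Laplacian. Let $f^1,\dots,f^N:\mathbb R^n\to\mathbb R$ be differentiable with, for constants $\rho_c,\varrho_c>0$ and all $i,z,z'$, $$(\nabla f^i(z)-\nabla f^i(z'))^{\top}(z-z')\ge\rho_c\|z-z'\|^2,\qquad \|\nabla f^i(z)-\nabla f^i(z')\|\le\varrho_c\|z-z'\|,$$ and let $z^*$ be a minimizer of $\sum_i f^i$. Put $$c_1=\max\{1/\lambda_2,\ (1+2\varrho_c^2)/(2\rho_c)\},\quad c_3=c_1\max\{1,1/\lambda_2\}+1,\quad c^*=1/(4c_3).$$ **Generator.** Let $\alpha\in\mathcal K_\infty$ be differentiable on $(0,\infty)$ with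 $\alpha'(s)\le\frac12c^*s^{-2}\alpha(s)^2$ for all $s>0$, and let $$\dot\varpi^i=-\alpha(\mu)\Big(\sum_j a_{ij}(\varpi^i-\varpi^j)+\nabla f^i(\varpi^i)+p^i\Big),\qquad \dot p^i=\alpha(\mu)\sum_j a_{ij}(\varpi^i-\varpi^j),\qquad \sum_i p^i(t_0)=0 .$$ **Agents.** Agent $i$ has state $x^i=(x^i_1,\dots,x^i_m)\in(\mathbb R^n)^m$, output $y^i=x^i_1$ and dynamics $\dot x^i_q=x^i_{q+1}$ ($1\le q<m$), $\dot x^i_m=u^i+\varphi^i(x^i,d^i(t))$, where $d^i$ takes values in a compact set $\mathbb D\subset\mathbb R^{n_d}$ and $\|\varphi^i(x,d)\|\le h^i(\|d\|)\,\psi^i(x)$ for all $x$ and all $d\in\mathbb D$, with a (possibly unknown) nondecreasing $h^i:[0,\infty)\to[0,\infty)$ and a known positive bounded function $\psi^i$. **Controller** (superscript $i$ omitted; all design data may depend on $i$). Let $K=(k_1,\dots,k_{m-1})^{\top}\in\mathbb R^{m-1}$ be such that the companion matrix $\Lambda=\begin{bmatrix}0&I_{m-2}\\-k_1&-k_2\cdots-k_{m-1}\end{bmatrix}$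 is Hurwitz, and let $P,Q$ be symmetric positive definite with $P(\Lambda\otimes I_n)+(\Lambda^{\top}\otimes I_n)P=-Q$. Put $v_1=\lambda_{\min}(Q)/\lambda_{\max}(P)$ and $v_2=2m\lambda_{\max}(P)/\lambda_{\min}(P)$. Let $\alpha_x\in\mathcal K_\infty$ be differentiable on $(0,\infty)$ and satisfy, for some $s_0>0$ and all $s>0$, * (DC1) $\alpha_x'(s)\le\frac{v_1}{2v_2}s^{-2}\alpha_x(s)^2$ and $\alpha_x(s)\le\frac{c^*}{v_1}\alpha(s)$; * (DC2) $\alpha_s(s)=\alpha_x(s)^m\exp\big(\frac{v_1}2\int_{s_0}^s\tau^{-2}\alpha_x(\tau)\,d\tau\big)$. Let $\delta_x(s)=\alpha_x'(s)s^2/\alpha_x(s)$, $\delta_s(s)=\alpha_s'(s)s^2/\alpha_s(s)$, $B(s)=k_1^{-1}\alpha_x(s)^{-(m-1)}$, and $$\tilde s=k_1^{-1}\Big(\sum_{j=1}^{m-1}k_j\,\alpha_x(\mu)^{-(j-1)}x_j+\alpha_x(\mu)^{-(m-1)}x_m\Big)-\varpi,\qquad \tilde e_s=\alpha_s(\mu)\tilde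 s,$$ $$\pi(x)=\alpha_x(\mu)^{m-1}\sum_{j=1}^{m-1}k_j\,\alpha_x(\mu)^{-(j-1)}\big(x_{j+1}-(j-1)\delta_x(\mu)x_j\big)-(m-1)\delta_x(\mu)x_m .$$ With a constant $v>0$, the controller, which uses $\varpi$ but none of its derivatives, is $$u=-(v+\psi(x)^2+1)\,\mathrm{sign}(k_1)\,\tilde e_s-\pi(x)-B(\mu)^{-1}\delta_s(\mu)\,\tilde s .$$ **Claim.** The distributed prescribed-time optimal agreement problem is solved. That is, along every trajectory of the closed loop (with arbitrary initial values subject to $\sum_ip^i(t_0)=0$) on an interval $[t_0,t_1)$ with $t_0<t_1\le t_0+T$, all of $\varpi^i$, $p^i$, $x^i$ (hence $y^i$) and $u^i$ are bounded; and if $t_1=t_0+T$, then $$\lim_{t\to t_0+T}\|y^i(t)-z^*\|=0,\qquad i=1,\dots,N .$$ -/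

import Mathlib

open Set Filter Topology
open scoped Kronecker Matrix

namespace DPTCO

noncomputable section

/-- Euclidean space `ℝⁿ`. -/
abbrev E (n : ℕ) := EuclideanSpace ℝ (Fin n)

/-- Class `K_∞` functions on `[0, ∞)`: continuous, strictly increasing, zero at zero, unbounded. -/
structure ClassKInf (α : ℝ → ℝ) : Prop where
  continuousOn : ContinuousOn α (Ici 0)
  strictMonoOn : StrictMonoOn α (Ici 0)
  map_zero : α 0 = 0
  tendsto_atTop : Tendsto α atTop atTop

/-! ### Communication graph -/

/-- A weighted undirected graph without self edges on the nodes `0, …, N - 1`, given by its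
weighted adjacency matrix. -/
structure WeightedGraph (N : ℕ) where
  weight : Matrix (Fin N) (Fin N) ℝ
  nonneg : ∀ i j, 0 ≤ weight i j
  symm : ∀ i j, weight i j = weight j i
  diag : ∀ i, weight i i = 0

namespace WeightedGraph

variable {N : ℕ} (G : WeightedGraph N)

/-- The underlying simple graph: `i` and `j` are adjacent iff `a_ij > 0`. -/
def graph : SimpleGraph (Fin N) where
  Adj i j := 0 < G.weight i j
  symm := ⟨fun i j h => by rwa [G.symm j i]⟩
  loopless := ⟨fun i h => by simp [G.diag i] at h⟩

/-- The graph Laplacian. -/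
def laplacian : Matrix (Fin N) (Fin N) ℝ :=
  Matrix.diagonal (fun i => ∑ j, G.weight i j) - G.weight

theorem laplacian_isHermitian : G.laplacian.IsHermitian := by
  refine Matrix.IsHermitian.sub (Matrix.isHermitian_diagonal _) ?_
  ext i j
  simp [Matrix.conjTranspose_apply, G.symm j i]

/-- The second smallest eigenvalue of the Laplacian, with multiplicity
(`eigenvalues₀` lists the `N` eigenvalues in decreasing order, starting at index `0`). -/
def lambda2 (hN : 2 ≤ N) : ℝ :=
  G.laplacian_isHermitian.eigenvalues₀ ⟨N - 2, by rw [Fintype.card_fin]; omega⟩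

end WeightedGraph

/-- The constant `c₁`, from `λ₂`, the strong convexity constant `ρ` and the Lipschitz
constant `ϱ` of the gradients. -/
def c1 (lam2 rho rhoL : ℝ) : ℝ := max (1 / lam2) ((1 + 2 * rhoL ^ 2) / (2 * rho))

/-- The constant `c₃`. -/
def c3 (lam2 rho rhoL : ℝ) : ℝ := c1 lam2 rho rhoL * max 1 (1 / lam2) + 1

/-- The constant `c^*`. -/
def cStar (lam2 rho rhoL : ℝ) : ℝ := 1 / (4 * c3 lam2 rho rhoL)

/-! ### Time-varying gain -/

/-- `μ(t) = 1 / (T + t₀ - t)`. -/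
def mu (t0 T t : ℝ) : ℝ := 1 / (T + t0 - t)

/-! ### Controller of one agent; the order of the chain is `m = r + 1` -/

/-- The smallest (real) eigenvalue of a symmetric real matrix. -/
def lamMin {ι : Type} [Fintype ι] [DecidableEq ι] (A : Matrix ι ι ℝ) : ℝ := sInf (spectrum ℝ A)

/-- The largest (real) eigenvalue of a symmetric real matrix. -/
def lamMax {ι : Type} [Fintype ι] [DecidableEq ι] (A : Matrix ι ι ℝ) : ℝ := sSup (spectrum ℝ A)

/-- The companion matrix `Λ = [0, I; -k₁, -k₂, …, -k_{m-1}]`, of size `r = m - 1`. -/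
def companion {r : ℕ} (K : Fin r → ℝ) : Matrix (Fin r) (Fin r) ℝ :=
  Matrix.of fun i j =>
    if (i : ℕ) + 1 = r then -K j else if (j : ℕ) = (i : ℕ) + 1 then 1 else 0

/-- All complex eigenvalues have negative real part. -/
def IsHurwitz {r : ℕ} (A : Matrix (Fin r) (Fin r) ℝ) : Prop :=
  ∀ z ∈ spectrum ℂ (A.map (algebraMap ℝ ℂ)), z.re < 0

/-- The design data of the local controller of one agent: the row `K`, matrices `P` and `Q`,
the gain function `α_x`, the base point `s₀` of the integral in `α_s`, the constant `v`, and the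
known function `ψ` of the state bounding the uncertainty. -/
structure Design (r n : ℕ) where
  K : Fin r → ℝ
  P : Matrix (Fin r × Fin n) (Fin r × Fin n) ℝ
  Q : Matrix (Fin r × Fin n) (Fin r × Fin n) ℝ
  alphaX : ℝ → ℝ
  s0 : ℝ
  v : ℝ
  psi : (Fin (r + 1) → E n) → ℝ

namespace Design

variable {r n : ℕ} (D : Design r n)

def v1 : ℝ := lamMin D.Q * (lamMax D.P)⁻¹

def v2 : ℝ := 2 * ((r : ℝ) + 1) * lamMax D.P * (lamMin D.P)⁻¹

/-- `α_s(s) = α_x(s)^m exp((v₁ / 2) ∫_{s₀}^s τ⁻² α_x(τ) dτ)`. -/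
def alphaS (s : ℝ) : ℝ :=
  D.alphaX s ^ (r + 1) * Real.exp (D.v1 / 2 * ∫ τ in D.s0..s, D.alphaX τ / τ ^ 2)

/-- `δ_x(s) = α_x'(s) s² / α_x(s)`. -/
def deltaX (s : ℝ) : ℝ := deriv D.alphaX s * s ^ 2 / D.alphaX s

/-- `δ_s(s) = α_s'(s) s² / α_s(s)`. -/
def deltaS (s : ℝ) : ℝ := deriv D.alphaS s * s ^ 2 / D.alphaS s

variable [NeZero r]

/-- `B(s) = k₁⁻¹ α_x(s)^{-(m-1)}`. -/
def B (s : ℝ) : ℝ := (D.K 0)⁻¹ * (D.alphaX s ^ r)⁻¹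

/-- `s̃ = k₁⁻¹ ([Kᵀ, 1] Φ(μ) ⊗ Iₙ) e_s` with `e_s = (x₁ - ϖ, x₂, …, x_m)` and
`Φ(μ) = diag(1, α_x(μ)⁻¹, …, α_x(μ)^{-(m-1)})`; here `s` is the value of `μ`. -/
def sTilde (s : ℝ) (x : Fin (r + 1) → E n) (w : E n) : E n :=
  (D.K 0)⁻¹ • ∑ q : Fin (r + 1),
    ((Fin.snoc D.K 1 : Fin (r + 1) → ℝ) q * (D.alphaX s ^ (q : ℕ))⁻¹) •
      (Function.update x 0 (x 0 - w)) q

/-- The time-varying state transformation `ẽ_s = α_s(μ) s̃`. -/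
def eTilde (s : ℝ) (x : Fin (r + 1) → E n) (w : E n) : E n :=
  D.alphaS s • D.sTilde s x w

/-- The `j`-th block `α_x(μ)^{-L_j} (x_{j+1} - L_j δ_x(μ) x_j)` of the derivative of
`r₁ = (x₁, α_x(μ)⁻¹ x₂, …, α_x(μ)^{-(m-2)} x_{m-1})`; with indices starting at `0`, `L_j = j`. -/
def r1Dot (s : ℝ) (x : Fin (r + 1) → E n) (j : Fin r) : E n :=
  (D.alphaX s ^ (j : ℕ))⁻¹ • (x j.succ - ((j : ℝ) * D.deltaX s) • x j.castSucc)

/-- `π(x) = α_x(μ)^{m-1} (Kᵀ ⊗ Iₙ) ṙ₁ - (m - 1) δ_x(μ) x_m`. -/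
def piTerm (s : ℝ) (x : Fin (r + 1) → E n) : E n :=
  D.alphaX s ^ r • (∑ j : Fin r, D.K j • D.r1Dot s x j)
    - ((r : ℝ) * D.deltaX s) • x (Fin.last r)

/-- The controller
`u = -(v + ψ(x)² + 1) sign(k₁) ẽ_s - π(x) - B(μ)⁻¹ δ_s(μ) s̃`.
It depends on the gain `s = μ(t)`, the state `x` of the agent and its reference `w = ϖ` only,
and on no derivative of the reference. -/
def control (s : ℝ) (x : Fin (r + 1) → E n) (w : E n) : E n :=
  -(((D.v + D.psi x ^ 2 + 1) * Real.sign (D.K 0)) • D.eTilde s x w)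
    - D.piTerm s x
    - ((D.B s)⁻¹ * D.deltaS s) • D.sTilde s x w

/-- The requirements on the design data, given the gain `α` of the generator and the
constant `c^*`. -/
structure Admissible (alpha : ℝ → ℝ) (cst : ℝ) : Prop where
  hurwitz : IsHurwitz (companion D.K)
  posDef_P : D.P.PosDef
  posDef_Q : D.Q.PosDef
  lyapunov : D.P * (companion D.K ⊗ₖ (1 : Matrix (Fin n) (Fin n) ℝ))
    + ((companion D.K)ᵀ ⊗ₖ (1 : Matrix (Fin n) (Fin n) ℝ)) * D.P = -D.Q
  alphaX_class : ClassKInf D.alphaX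
  alphaX_diff : ∀ s, 0 < s → DifferentiableAt ℝ D.alphaX s
  dc1_deriv : ∀ s, 0 < s →
    deriv D.alphaX s ≤ D.v1 / (2 * D.v2) * (s ^ 2)⁻¹ * D.alphaX s ^ 2
  dc1_le : ∀ s, 0 < s → D.alphaX s ≤ cst / D.v1 * alpha s
  s0_pos : 0 < D.s0
  v_pos : 0 < D.v
  psi_pos : ∀ x, 0 < D.psi x
  psi_bdd : ∃ M, ∀ x, D.psi x ≤ M

end Design

/-! ### Closed loop -/

/-- `(ϖ, p, x)` is a trajectory on `[t₀, t₁)` of the closed loop: generator, chain integrators and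
controllers. Trajectories are continuous and satisfy the differential equations with derivatives
from the right at every time; this includes all classical solutions, and also allows
disturbances with jumps. -/
structure IsTrajectory {N r n nd : ℕ} [NeZero r] (G : WeightedGraph N)
    (f : Fin N → E n → ℝ) (alpha : ℝ → ℝ) (D : Fin N → Design r n)
    (phi : Fin N → (Fin (r + 1) → E n) → E nd → E n) (d : Fin N → ℝ → E nd)
    (t0 T t1 : ℝ) (w p : Fin N → ℝ → E n) (x : Fin N → ℝ → Fin (r + 1) → E n) : Prop where
  continuousOn_w : ∀ i, ContinuousOn (w i) (Ico t0 t1)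
  continuousOn_p : ∀ i, ContinuousOn (p i) (Ico t0 t1)
  continuousOn_x : ∀ i, ContinuousOn (x i) (Ico t0 t1)
  deriv_w : ∀ i, ∀ t ∈ Ico t0 t1, HasDerivWithinAt (w i)
    (-(alpha (mu t0 T t) •
      (∑ j, G.weight i j • (w i t - w j t) + gradient (f i) (w i t) + p i t))) (Ici t) t
  deriv_p : ∀ i, ∀ t ∈ Ico t0 t1, HasDerivWithinAt (p i)
    (alpha (mu t0 T t) • ∑ j, G.weight i j • (w i t - w j t)) (Ici t) t
  deriv_x : ∀ i, ∀ t ∈ Ico t0 t1, ∀ q : Fin r,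
    HasDerivWithinAt (fun s => x i s q.castSucc) (x i t q.succ) (Ici t) t
  deriv_x_last : ∀ i, ∀ t ∈ Ico t0 t1,
    HasDerivWithinAt (fun s => x i s (Fin.last r))
      ((D i).control (mu t0 T t) (x i t) (w i t) + phi i (x i t) (d i t)) (Ici t) t

end

end DPTCO

/-! The closed loop is a cascade: the generator drives the filtered error `s̃` of each agent, which
drives its chain of integrators. Each stage has a quadratic energy, and the time-varying gains enter
only as weights. Since `μ' = μ²`, a weight `α(μ)` has logarithmic derivative `α'(μ) μ² / α(μ)`, and
the growth conditions bound this by a small multiple of a gain. Hence the weights grow no faster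
than the energies decay, and bounded weighted errors become vanishing errors because the weights
blow up at `t₀ + T`.

Generator. In the errors `e = ϖ - z*` and `q = p + ∇f(z*)`, the sum of `q` stays zero, so `q` lies
in the range of the Laplacian. The energy combines `‖e‖²`, the pseudo-inverse Laplacian form of `q`,
and `‖e + q‖²`. The second term cancels the coupling of `e` and `q`; the third yields damping in
`q`. This gives `V' ≤ -2 c* α(μ) V` (`genEnergy_dissipation`, `exists_generator_energy`), so
`α_x(μ)^m ‖ϖ - z*‖` and `α_x(μ)^(m-1) ‖ϖ'‖` are bounded (`weighted_energy_le`).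

Filtered error. In the dynamics of `ẽ_s = α_s(μ) s̃` the controller cancels all known terms.
Uncertainty, `ϖ'` and damping then share the factor `α_s |B|`, so `ẽ_s` is bounded without knowledge
of `ϖ'` (`exists_norm_eTilde_le`). Because `α_s` dominates a multiple of `α_x^m`, so is `α_x(μ)^m
s̃`.

Chain. The scaled errors `α_x^(m-q) (x_q - [q = 0] z*)` satisfy `X' = α_x (Λ X + Y)` up to terms of
size `δ_x X`, with `Y` bounded by the previous stages. The Lyapunov matrix `P` absorbs the `δ_x`
terms (`chain_dissipation`, `exists_norm_scaledError_le`). State and input are bounded in terms of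
these errors, and their zeroth entry gives `‖y - z*‖ = O(α_x(μ)^(-m))`. -/

namespace DPTCO

/-! ### Spectral theory of the graph Laplacian. -/

namespace WeightedGraph

variable {N : ℕ} (G : WeightedGraph N)

theorem laplacian_mulVec (x : Fin N → ℝ) (i : Fin N) :
    (G.laplacian *ᵥ x) i = ∑ j, G.weight i j * (x i - x j) := by
  rw [laplacian, Matrix.sub_mulVec, Pi.sub_apply, Matrix.mulVec_diagonal, Matrix.mulVec, dotProduct,
    Finset.sum_mul, ← Finset.sum_sub_distrib]
  exact Finset.sum_congr rfl fun j _ => by ring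

theorem sum_weight_smul_sub_eq_zero {F : Type*} [AddCommGroup F] [Module ℝ F] (x : Fin N → F) :
    ∑ i, ∑ j, G.weight i j • (x i - x j) = 0 := by
  have h : ∑ i, ∑ j, G.weight i j • x j = ∑ i, ∑ j, G.weight i j • x i := by
    rw [Finset.sum_comm]
    exact Finset.sum_congr rfl fun i _ => Finset.sum_congr rfl fun j _ => by rw [G.symm]
  simp only [smul_sub, Finset.sum_sub_distrib, h, sub_self]

/-- The Dirichlet form of a weighted graph. -/
theorem sum_mul_laplacian (x : Fin N → ℝ) :
    ∑ i, x i * ∑ j, G.weight i j * (x i - x j)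
      = (∑ i, ∑ j, G.weight i j * (x i - x j) ^ 2) / 2 := by
  have h : ∑ i, ∑ j, G.weight i j * (x i * (x i - x j))
      = ∑ i, ∑ j, G.weight i j * (x j * (x j - x i)) := by
    rw [Finset.sum_comm]
    exact Finset.sum_congr rfl fun i _ => Finset.sum_congr rfl fun j _ => by rw [G.symm]
  have h1 : ∑ i, x i * ∑ j, G.weight i j * (x i - x j)
      = ∑ i, ∑ j, G.weight i j * (x i * (x i - x j)) := by
    simp only [Finset.mul_sum]
    exact Finset.sum_congr rfl fun i _ => Finset.sum_congr rfl fun j _ => by ring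
  have h2 : ∑ i, ∑ j, G.weight i j * (x i - x j) ^ 2
      = ∑ i, ∑ j, G.weight i j * (x i * (x i - x j))
        + ∑ i, ∑ j, G.weight i j * (x j * (x j - x i)) := by
    simp only [← Finset.sum_add_distrib]
    exact Finset.sum_congr rfl fun i _ => Finset.sum_congr rfl fun j _ => by ring
  rw [h1, h2, ← h]; ring

/-- All summands are nonnegative, hence zero, so `x` agrees across each edge and therefore along
each walk. -/
theorem eq_of_sum_weight_mul_sq_eq_zero (hG : G.graph.Connected) {x : Fin N → ℝ}
    (hx : ∑ i, ∑ j, G.weight i j * (x i - x j) ^ 2 = 0) (i j : Fin N) : x i = x j := by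
  have hadj : ∀ i j, G.graph.Adj i j → x i = x j := by
    intro i j hij
    have hnn : ∀ i j, 0 ≤ G.weight i j * (x i - x j) ^ 2 := fun i j =>
      mul_nonneg (G.nonneg i j) (sq_nonneg _)
    have h1 := (Finset.sum_eq_zero_iff_of_nonneg
      (fun i _ => Finset.sum_nonneg fun j _ => hnn i j)).1 hx i (Finset.mem_univ i)
    have h2 := (Finset.sum_eq_zero_iff_of_nonneg (fun j _ => hnn i j)).1 h1 j (Finset.mem_univ j)
    have hw : 0 < G.weight i j := hij
    have h3 : (x i - x j) ^ 2 = 0 := (mul_eq_zero.1 h2).resolve_left hw.ne'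
    exact sub_eq_zero.1 (pow_eq_zero_iff two_ne_zero |>.1 h3)
  obtain ⟨q⟩ := hG.preconnected i j
  induction q with
  | nil => rfl
  | cons h _ ih => exact (hadj _ _ h).trans ih

/-- Spectral decomposition of the Laplacian of a connected graph: orthonormal eigenvectors `v i`,
the one with index `i₀` constant, and all eigenvalues other than the zero one at least `λ₂ > 0`. -/
theorem exists_spectral_decomposition (hN : 2 ≤ N) (hG : G.graph.Connected) :
    0 < G.lambda2 hN ∧ ∃ (v : Fin N → Fin N → ℝ) (l : Fin N → ℝ) (i₀ : Fin N),
      (∀ j k, ∑ i, v i j * v i k = if j = k then 1 else 0) ∧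
      (∀ i j, ∑ k, G.weight j k * (v i j - v i k) = l i * v i j) ∧
      l i₀ = 0 ∧ (∀ j k, v i₀ j = v i₀ k) ∧ ∀ i, i ≠ i₀ → G.lambda2 hN ≤ l i := by
  set hA := G.laplacian_isHermitian
  set b := hA.eigenvectorBasis
  set l := hA.eigenvalues
  set v : Fin N → Fin N → ℝ := fun i j => b i j with hv
  have hcol : ∀ i k, ∑ j, v i j * v k j = if i = k then 1 else 0 := by
    intro i k
    have := orthonormal_iff_ite.1 b.orthonormal i k
    rw [← this, PiLp.inner_apply]
    exact Finset.sum_congr rfl fun j _ => by simp [hv, mul_comm]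
  -- Completeness of the basis: the matrix with the eigenvectors as rows also has orthonormal
  -- columns.
  have hrow : ∀ j k, ∑ i, v i j * v i k = if j = k then 1 else 0 := by
    intro j k
    have := b.sum_inner_mul_inner (EuclideanSpace.single j 1) (EuclideanSpace.single k 1)
    rw [EuclideanSpace.inner_single_left] at this
    simp only [EuclideanSpace.inner_single_left, EuclideanSpace.inner_single_right] at this
    simpa [hv, Pi.single_apply] using this
  have heig : ∀ i j, ∑ k, G.weight j k * (v i j - v i k) = l i * v i j := by
    intro i j
    rw [← laplacian_mulVec]
    have := congrFun (hA.mulVec_eigenvectorBasis i) j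
    simpa using this
  have hdir : ∀ i, (∑ j, ∑ k, G.weight j k * (v i j - v i k) ^ 2) / 2 = l i := by
    intro i
    rw [← sum_mul_laplacian]
    have h1 := hcol i i
    rw [if_pos rfl] at h1
    calc _ = ∑ j, l i * (v i j * v i j) :=
          Finset.sum_congr rfl fun j _ => by rw [heig]; ring
      _ = l i := by rw [← Finset.mul_sum, h1, mul_one]
  have hnn : ∀ i, 0 ≤ l i := fun i => by
    rw [← hdir]
    exact div_nonneg (Finset.sum_nonneg fun j _ => Finset.sum_nonneg fun k _ =>
      mul_nonneg (G.nonneg j k) (sq_nonneg _)) zero_le_two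
  have hconst : ∀ i, l i = 0 → ∀ j k, v i j = v i k := by
    intro i hi
    have := hdir i
    rw [hi] at this
    exact G.eq_of_sum_weight_mul_sq_eq_zero hG (by linarith)
  -- Two constant vectors of norm one cannot be orthogonal, so the kernel is one-dimensional.
  have huniq : ∀ i k, l i = 0 → l k = 0 → i = k := by
    intro i k hi hk
    by_contra hne
    have h0 := hcol i k
    rw [if_neg hne] at h0
    have hi1 := hcol i i
    have hk1 := hcol k k
    rw [if_pos rfl] at hi1 hk1
    have e1 : ∀ j, v i j = v i i := fun j => hconst i hi j i
    have e2 : ∀ j, v k j = v k i := fun j => hconst k hk j i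
    simp only [e1, e2, Finset.sum_const, Finset.card_univ, Fintype.card_fin, nsmul_eq_mul]
      at h0 hi1 hk1
    rcases mul_eq_zero.1 h0 with h | h
    · rw [h, zero_mul] at hi1; exact zero_ne_one hi1
    · rcases mul_eq_zero.1 h with h | h
      · rw [h, mul_zero, mul_zero] at hi1; exact zero_ne_one hi1
      · rw [h, mul_zero, mul_zero] at hk1; exact zero_ne_one hk1
  set σ : Fin (Fintype.card (Fin N)) ≃ Fin N := Fintype.equivOfCardEq (Fintype.card_fin _)
    with hσ
  have hl : ∀ i, l i = hA.eigenvalues₀ (σ.symm i) := fun i => rfl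
  have hcard : Fintype.card (Fin N) = N := Fintype.card_fin N
  set i₀ : Fin N := σ ⟨N - 1, by omega⟩ with hi₀
  set i₁ : Fin N := σ ⟨N - 2, by omega⟩ with hi₁
  have hne : i₁ ≠ i₀ := by
    intro h
    have := σ.injective h
    simp only [Fin.mk.injEq] at this
    omega
  have hmin : ∀ i, l i₀ ≤ l i := by
    intro i
    rw [hl, hl]
    apply hA.eigenvalues₀_antitone
    rw [hi₀, Equiv.symm_apply_apply, Fin.le_def]
    have := (σ.symm i).2
    simp only
    omega
  have hl1 : l i₁ = G.lambda2 hN := by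
    rw [hl, hi₁, Equiv.symm_apply_apply]; rfl
  -- If no eigenvalue were zero, every eigenvector would sum to zero, since the image of the
  -- Laplacian does. By completeness no nonzero vector can be orthogonal to all of them, yet the
  -- all-ones vector would be.
  have hl0 : l i₀ = 0 := by
    by_contra h0
    have hpos : ∀ i, l i ≠ 0 := fun i hi =>
      h0 (le_antisymm (hi ▸ hmin i) (hnn i₀))
    have hsum : ∀ i, ∑ j, v i j = 0 := by
      intro i
      have h1 : l i * ∑ j, v i j = 0 := by
        rw [Finset.mul_sum, ← G.sum_weight_smul_sub_eq_zero (v i)]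
        exact Finset.sum_congr rfl fun j _ => by simp only [smul_eq_mul, heig]
      exact (mul_eq_zero.1 h1).resolve_left (hpos i)
    have h2 : ∑ k, ∑ i, v i i₀ * v i k = 1 := by
      simp only [hrow]; simp
    rw [Finset.sum_comm] at h2
    simp only [← Finset.mul_sum, hsum, mul_zero, Finset.sum_const_zero] at h2
    exact zero_ne_one h2
  have hl2 : 0 < G.lambda2 hN := by
    rw [← hl1]
    exact lt_of_le_of_ne (hnn _) fun h => hne (huniq _ _ h.symm hl0)
  refine ⟨hl2, v, l, i₀, hrow, heig, hl0, hconst _ hl0, fun i hi => ?_⟩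
  rw [← hl1, hl, hl]
  apply hA.eigenvalues₀_antitone
  rw [hi₁, Equiv.symm_apply_apply, Fin.le_def]
  have h1 := (σ.symm i).2
  have h2 : ((σ.symm i : Fin _) : ℕ) ≠ N - 1 := by
    intro h
    apply hi
    rw [hi₀, ← σ.symm_apply_eq]
    exact Fin.ext h
  simp only
  omega

end WeightedGraph

/-! ### Change to the eigenbasis for vector-valued nodes. -/

section Transform

variable {ι F : Type*} [Fintype ι] [DecidableEq ι] [NormedAddCommGroup F] [InnerProductSpace ℝ F]

/-- Parseval's identity for vectors with entries in an inner product space. -/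
theorem sum_inner_sum_smul {v : ι → ι → ℝ}
    (hv : ∀ j k, ∑ i, v i j * v i k = if j = k then 1 else 0) (x y : ι → F) :
    ∑ i, inner ℝ (∑ j, v i j • x j) (∑ j, v i j • y j) = ∑ j, inner ℝ (x j) (y j) := by
  simp only [sum_inner, inner_sum, real_inner_smul_left, real_inner_smul_right]
  rw [Finset.sum_comm]
  refine Finset.sum_congr rfl fun j _ => ?_
  rw [Finset.sum_comm]
  have h : ∀ k, ∑ i, v i j * (v i k * inner ℝ (x k) (y j))
      = (if j = k then 1 else 0) * inner ℝ (x k) (y j) := fun k => by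
    rw [← hv, Finset.sum_mul]
    exact Finset.sum_congr rfl fun i _ => by ring
  simp [h]

end Transform

theorem c1_pos {lam2 rho rhoL : ℝ} (hl : 0 < lam2) : 0 < c1 lam2 rho rhoL :=
  lt_of_lt_of_le (one_div_pos.2 hl) (le_max_left _ _)

theorem c3_pos {lam2 rho rhoL : ℝ} (hl : 0 < lam2) : 0 < c3 lam2 rho rhoL :=
  add_pos (mul_pos (c1_pos hl) (lt_max_of_lt_left one_pos)) one_pos

theorem cStar_pos {lam2 rho rhoL : ℝ} (hl : 0 < lam2) : 0 < cStar lam2 rho rhoL :=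
  one_div_pos.2 (mul_pos four_pos (c3_pos hl))

/-! ### Energy of the generator and its dissipation. -/

section Generator

variable {N : ℕ} {F : Type*} [NormedAddCommGroup F] [InnerProductSpace ℝ F]

/-- Twice the Lyapunov function of the generator, in the error variables `e` and `q`. -/
noncomputable def genEnergy (c : ℝ) (v : Fin N → Fin N → ℝ) (l : Fin N → ℝ) (e q : Fin N → F) :
    ℝ :=
  c * (∑ i, ‖e i‖ ^ 2 + ∑ i, (l i)⁻¹ * ‖∑ j, v i j • q j‖ ^ 2) + ∑ i, ‖e i + q i‖ ^ 2

variable {c : ℝ} {v : Fin N → Fin N → ℝ} {l : Fin N → ℝ}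

theorem hasDerivWithinAt_genEnergy {e q : ℝ → Fin N → F} {e' q' : Fin N → F} {s : Set ℝ} {t : ℝ}
    (he : ∀ i, HasDerivWithinAt (fun t => e t i) (e' i) s t)
    (hq : ∀ i, HasDerivWithinAt (fun t => q t i) (q' i) s t) :
    HasDerivWithinAt (fun t => genEnergy c v l (e t) (q t))
      (2 * (c * (∑ i, inner ℝ (e t i) (e' i) +
        ∑ i, (l i)⁻¹ * inner ℝ (∑ j, v i j • q t j) (∑ j, v i j • q' j))
        + ∑ i, inner ℝ (e t i + q t i) (e' i + q' i))) s t := by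
  unfold genEnergy
  have h1 := HasDerivWithinAt.fun_sum fun i (_ : i ∈ Finset.univ) => (he i).norm_sq
  have h2 := HasDerivWithinAt.fun_sum fun i (_ : i ∈ Finset.univ) =>
    ((HasDerivWithinAt.fun_sum fun j (_ : j ∈ Finset.univ) =>
      (hq j).const_smul (v i j)).norm_sq).const_mul (l i)⁻¹
  have h3 := HasDerivWithinAt.fun_sum fun i (_ : i ∈ Finset.univ) => ((he i).add (hq i)).norm_sq
  refine (((h1.add h2).const_mul c).add h3).congr_deriv ?_
  simp only [Pi.add_apply, Pi.smul_apply, mul_left_comm _ (2 : ℝ), ← Finset.mul_sum]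
  ring

theorem continuousOn_genEnergy {e q : ℝ → Fin N → F} {s : Set ℝ}
    (he : ∀ i, ContinuousOn (fun t => e t i) s) (hq : ∀ i, ContinuousOn (fun t => q t i) s) :
    ContinuousOn (fun t => genEnergy c v l (e t) (q t)) s := by
  unfold genEnergy
  fun_prop

variable {G : WeightedGraph N}

theorem le_genEnergy (hc : 0 ≤ c) (hl : ∀ i, 0 ≤ l i) (e q : Fin N → F) (i : Fin N) :
    c * ‖e i‖ ^ 2 + ‖e i + q i‖ ^ 2 ≤ genEnergy c v l e q := by
  have h1 : ‖e i‖ ^ 2 ≤ ∑ i, ‖e i‖ ^ 2 :=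
    Finset.single_le_sum (f := fun i => ‖e i‖ ^ 2) (fun i _ => sq_nonneg _) (Finset.mem_univ i)
  have h2 : ‖e i + q i‖ ^ 2 ≤ ∑ i, ‖e i + q i‖ ^ 2 :=
    Finset.single_le_sum (f := fun i => ‖e i + q i‖ ^ 2) (fun i _ => sq_nonneg _)
      (Finset.mem_univ i)
  have h3 : 0 ≤ ∑ i, (l i)⁻¹ * ‖∑ j, v i j • q j‖ ^ 2 :=
    Finset.sum_nonneg fun i _ => mul_nonneg (inv_nonneg.2 (hl i)) (sq_nonneg _)
  unfold genEnergy
  gcongr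
  linarith

/-- The error `q i` is recovered as `(e i + q i) - e i`; the spectral term of the energy is not
needed here. -/
theorem norm_le_sqrt_genEnergy (hc : 0 < c) (hl : ∀ i, 0 ≤ l i) (e q : Fin N → F) (i : Fin N) :
    ‖e i‖ ≤ (Real.sqrt c⁻¹ + 1) * Real.sqrt (genEnergy c v l e q) ∧
      ‖q i‖ ≤ (Real.sqrt c⁻¹ + 1) * Real.sqrt (genEnergy c v l e q) := by
  have h := le_genEnergy (v := v) hc.le hl e q i
  have h1 : ‖e i‖ ≤ Real.sqrt c⁻¹ * Real.sqrt (genEnergy c v l e q) := by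
    rw [← Real.sqrt_mul (inv_nonneg.2 hc.le)]
    apply Real.le_sqrt_of_sq_le
    rw [inv_mul_eq_div, le_div_iff₀ hc]
    nlinarith [sq_nonneg ‖e i + q i‖]
  have h2 : ‖e i + q i‖ ≤ Real.sqrt (genEnergy c v l e q) := by
    apply Real.le_sqrt_of_sq_le
    nlinarith [mul_nonneg hc.le (sq_nonneg ‖e i‖)]
  have h3 : ‖q i‖ ≤ ‖e i + q i‖ + ‖e i‖ := by
    have := norm_sub_le (e i + q i) (e i)
    rwa [add_sub_cancel_left] at this
  have h4 := Real.sqrt_nonneg (genEnergy c v l e q)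
  constructor <;> linarith

/-- The decay estimate for the generator in the time scale of its gain. -/
theorem genEnergy_dissipation {lam2 rho rhoL : ℝ} (hlam : 0 < lam2) (hrho : 0 < rho)
    {i₀ : Fin N} (hv : ∀ j k, ∑ i, v i j * v i k = if j = k then 1 else 0)
    (heig : ∀ i j, ∑ k, G.weight j k * (v i j - v i k) = l i * v i j)
    (hl₀ : l i₀ = 0) (hv₀ : ∀ j k, v i₀ j = v i₀ k) (hl : ∀ i, i ≠ i₀ → lam2 ≤ l i)
    (e q g : Fin N → F) (hq : ∑ i, q i = 0)
    (hconv : ∀ i, rho * ‖e i‖ ^ 2 ≤ inner ℝ (g i) (e i)) (hlip : ∀ i, ‖g i‖ ≤ rhoL * ‖e i‖)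
    {e' q' : Fin N → F} (hq' : ∀ i, q' i = ∑ j, G.weight i j • (e i - e j))
    (he' : ∀ i, e' i = -(q' i + g i + q i)) :
    2 * (c1 lam2 rho rhoL * (∑ i, inner ℝ (e i) (e' i) +
        ∑ i, (l i)⁻¹ * inner ℝ (∑ j, v i j • q j) (∑ j, v i j • q' j))
        + ∑ i, inner ℝ (e i + q i) (e' i + q' i))
      ≤ -(2 * cStar lam2 rho rhoL) * genEnergy (c1 lam2 rho rhoL) v l e q := by
  set c := c1 lam2 rho rhoL
  have hc : 0 < c := c1_pos hlam
  set ce : Fin N → F := fun i => ∑ j, v i j • e j with hce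
  set cq : Fin N → F := fun i => ∑ j, v i j • q j with hcq
  have hcl : ∀ i, ∑ j, v i j • q' j = l i • ce i := by
    intro i
    have h : ∑ j, ∑ k, (G.weight j k * v i j) • e k = ∑ j, ∑ k, (G.weight j k * v i k) • e j := by
      rw [Finset.sum_comm]
      exact Finset.sum_congr rfl fun i _ => Finset.sum_congr rfl fun j _ => by rw [G.symm]
    calc ∑ j, v i j • q' j
        = ∑ j, ∑ k, (G.weight j k * v i j) • e j - ∑ j, ∑ k, (G.weight j k * v i j) • e k := by
          rw [← Finset.sum_sub_distrib]
          refine Finset.sum_congr rfl fun j _ => ?_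
          rw [← Finset.sum_sub_distrib, hq', Finset.smul_sum]
          exact Finset.sum_congr rfl fun k _ => by module
      _ = ∑ j, (l i * v i j) • e j := by
          rw [h, ← Finset.sum_sub_distrib]
          refine Finset.sum_congr rfl fun j _ => ?_
          rw [← Finset.sum_sub_distrib, ← heig, Finset.sum_smul]
          exact Finset.sum_congr rfl fun k _ => by module
      _ = l i • ce i := by
          rw [hce, Finset.smul_sum]
          exact Finset.sum_congr rfl fun j _ => by module
  have hcq₀ : cq i₀ = 0 := by
    have : cq i₀ = v i₀ i₀ • ∑ j, q j := by
      rw [hcq, Finset.smul_sum]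
      exact Finset.sum_congr rfl fun j _ => by rw [hv₀ j i₀]
    rw [this, hq, smul_zero]
  -- With `0⁻¹ = 0` the weights `(l i)⁻¹` form the pseudo-inverse of the Laplacian. It acts as an
  -- inverse on `q`, which has no component along the constant mode.
  have hzero : ∀ i, (l i)⁻¹ * l i = 1 ∨ cq i = 0 ∧ l i = 0 := by
    intro i
    by_cases hi : i = i₀
    · exact Or.inr ⟨hi ▸ hcq₀, hi ▸ hl₀⟩
    · exact Or.inl (inv_mul_cancel₀ (hlam.trans_le (hl i hi)).ne')
  set Ee := ∑ i, ‖e i‖ ^ 2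
  set Qq := ∑ i, ‖q i‖ ^ 2 with hQq
  set eq := ∑ i, inner ℝ (e i) (q i) with heq
  set eg := ∑ i, inner ℝ (e i) (g i) with heg
  set qg := ∑ i, inner ℝ (q i) (g i) with hqg
  set el := ∑ i, inner ℝ (e i) (q' i) with hel
  -- This term cancels the `-eq` in `hS2`, which is why the energy contains the pseudo-inverse form.
  have hS1 : ∑ i, (l i)⁻¹ * inner ℝ (cq i) (∑ j, v i j • q' j) = eq := by
    rw [heq, ← sum_inner_sum_smul hv]
    refine Finset.sum_congr rfl fun i _ => ?_
    rw [hcl, real_inner_smul_right, ← mul_assoc]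
    rcases hzero i with h | ⟨h, h'⟩
    · rw [h, one_mul, real_inner_comm]
    · change _ = inner ℝ (ce i) (cq i)
      rw [h, inner_zero_left, inner_zero_right, mul_zero]
  have hS2 : ∑ i, inner ℝ (e i) (e' i) = -el - eg - eq := by
    rw [hel, heg, heq, ← Finset.sum_neg_distrib, ← Finset.sum_sub_distrib,
      ← Finset.sum_sub_distrib]
    refine Finset.sum_congr rfl fun i _ => ?_
    rw [he', inner_neg_right, inner_add_right, inner_add_right]; ring
  have hS3 : ∑ i, inner ℝ (e i + q i) (e' i + q' i) = -eg - eq - qg - Qq := by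
    rw [heg, heq, hqg, hQq, ← Finset.sum_neg_distrib, ← Finset.sum_sub_distrib,
      ← Finset.sum_sub_distrib, ← Finset.sum_sub_distrib]
    refine Finset.sum_congr rfl fun i _ => ?_
    rw [he', show -(q' i + g i + q i) + q' i = -(g i + q i) by abel, inner_neg_right,
      inner_add_right, inner_add_left, inner_add_left, real_inner_self_eq_norm_sq]; ring
  have hB1 : rho * Ee ≤ eg := by
    rw [Finset.mul_sum]
    exact Finset.sum_le_sum fun i _ => by rw [real_inner_comm]; exact hconv i
  have hB2 : -qg ≤ rhoL ^ 2 * Ee + Qq / 4 := by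
    rw [Finset.mul_sum, Finset.sum_div, ← Finset.sum_neg_distrib, ← Finset.sum_add_distrib]
    refine Finset.sum_le_sum fun i _ => ?_
    have h1 := neg_le_of_abs_le (abs_real_inner_le_norm (q i) (g i))
    have h2 := hlip i
    have h3 := mul_le_mul_of_nonneg_left h2 (norm_nonneg (q i))
    nlinarith [sq_nonneg (rhoL * ‖e i‖ - ‖q i‖ / 2)]
  -- The cross term left over from `‖e + q‖²` is absorbed mode by mode: `c * l i ≥ 1` off the
  -- constant mode, by the first entry of the maximum in `c1`.
  have hB3 : 0 ≤ c * el + eq + Qq / 4 := by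
    have h1 : el = ∑ i, l i * ‖ce i‖ ^ 2 := by
      rw [hel, ← sum_inner_sum_smul hv]
      refine Finset.sum_congr rfl fun i _ => ?_
      rw [hcl, real_inner_smul_right, ← real_inner_self_eq_norm_sq]
    have h2 : eq = ∑ i, inner ℝ (ce i) (cq i) := (sum_inner_sum_smul hv _ _).symm
    have h3 : Qq = ∑ i, ‖cq i‖ ^ 2 := by
      simp only [hQq, ← real_inner_self_eq_norm_sq]
      exact (sum_inner_sum_smul hv _ _).symm
    rw [h1, h2, h3, Finset.mul_sum, Finset.sum_div, ← Finset.sum_add_distrib,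
      ← Finset.sum_add_distrib]
    refine Finset.sum_nonneg fun i _ => ?_
    by_cases hi : i = i₀
    · rw [hi, hcq₀, hl₀]; simp
    · have h4 : 1 ≤ c * l i := by
        calc (1 : ℝ) = 1 / lam2 * lam2 := by field_simp
          _ ≤ c * l i := mul_le_mul (le_max_left _ _) (hl i hi) hlam.le hc.le
      have h5 := neg_le_of_abs_le (abs_real_inner_le_norm (ce i) (cq i))
      nlinarith [sq_nonneg (‖ce i‖ - ‖cq i‖ / 2),
        mul_le_mul_of_nonneg_right h4 (sq_nonneg ‖ce i‖)]
  have hEe : 0 ≤ Ee := Finset.sum_nonneg fun i _ => sq_nonneg _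
  have hQq0 : 0 ≤ Qq := Finset.sum_nonneg fun i _ => sq_nonneg _
  -- The second entry of the maximum in `c1` pays for the `rhoL ^ 2 * Ee` of `hB2` and leaves `Ee /
  -- 2`.
  have hB4 : (1 / 2 + rhoL ^ 2) * Ee ≤ c * eg := by
    have h1 : (1 + 2 * rhoL ^ 2) / (2 * rho) ≤ c := le_max_right _ _
    rw [div_le_iff₀ (by positivity)] at h1
    nlinarith [mul_le_mul_of_nonneg_left hB1 hc.le, mul_le_mul_of_nonneg_right h1 hEe]
  have hB5 : 0 ≤ eg := (mul_nonneg hrho.le hEe).trans hB1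
  have hV : genEnergy c v l e q ≤ 2 * c3 lam2 rho rhoL * (Ee + Qq) := by
    have hm1 : 1 ≤ max 1 (1 / lam2) := le_max_left _ _
    have h1 : ∑ i, (l i)⁻¹ * ‖cq i‖ ^ 2 ≤ max 1 (1 / lam2) * Qq := by
      have h3 : Qq = ∑ i, ‖cq i‖ ^ 2 := by
        simp only [hQq, ← real_inner_self_eq_norm_sq]
        exact (sum_inner_sum_smul hv _ _).symm
      rw [h3, Finset.mul_sum]
      refine Finset.sum_le_sum fun i _ => mul_le_mul_of_nonneg_right ?_ (sq_nonneg _)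
      by_cases hi : i = i₀
      · rw [hi, hl₀, inv_zero]; linarith
      · rw [← one_div]
        exact (one_div_le_one_div_of_le hlam (hl i hi)).trans (le_max_right _ _)
    have h2 : ∑ i, ‖e i + q i‖ ^ 2 ≤ 2 * (Ee + Qq) := by
      rw [← Finset.sum_add_distrib, Finset.mul_sum]
      refine Finset.sum_le_sum fun i _ => ?_
      have := norm_add_le (e i) (q i)
      nlinarith [norm_nonneg (e i + q i), norm_nonneg (e i), norm_nonneg (q i),
        sq_nonneg (‖e i‖ - ‖q i‖)]
    have h4 : Ee ≤ max 1 (1 / lam2) * Ee := le_mul_of_one_le_left hEe hm1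
    have h5 : c * (Ee + ∑ i, (l i)⁻¹ * ‖cq i‖ ^ 2) ≤ c * (max 1 (1 / lam2) * (Ee + Qq)) :=
      mul_le_mul_of_nonneg_left (by linarith) hc.le
    have h6 : 0 ≤ c * (max 1 (1 / lam2) * (Ee + Qq)) := by positivity
    calc genEnergy c v l e q ≤ c * (max 1 (1 / lam2) * (Ee + Qq)) + 2 * (Ee + Qq) :=
          add_le_add h5 h2
      _ ≤ 2 * (c * max 1 (1 / lam2) + 1) * (Ee + Qq) := by linarith
  have hstar : cStar lam2 rho rhoL * (2 * c3 lam2 rho rhoL) = 1 / 2 := by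
    have := (c3_pos (rho := rho) (rhoL := rhoL) hlam).ne'
    rw [cStar]; field_simp; norm_num
  have hcs : 0 < cStar lam2 rho rhoL := cStar_pos hlam
  have h7 := mul_le_mul_of_nonneg_left hV hcs.le
  rw [← mul_assoc, hstar] at h7
  change 2 * (c * (_ + ∑ i, (l i)⁻¹ * inner ℝ (cq i) _) + _) ≤ _
  rw [hS1, hS2, hS3]
  linarith

end Generator

/-! ### Comparison principles for right derivatives. -/

/-- A function whose right derivative is at most `g (M - κ V)` stays bounded. -/
theorem le_max_of_deriv_right_le {V V' g : ℝ → ℝ} {a b κ M : ℝ} (hκ : 0 < κ)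
    (hcont : ContinuousOn V (Ico a b))
    (hderiv : ∀ t ∈ Ico a b, HasDerivWithinAt V (V' t) (Ici t) t)
    (hg : ∀ t ∈ Ico a b, 0 < g t) (hle : ∀ t ∈ Ico a b, V' t ≤ g t * (M - κ * V t)) :
    ∀ t ∈ Ico a b, V t ≤ max (V a) (M / κ + 1) := by
  intro t ht
  have hsub : Icc a t ⊆ Ico a b := fun s hs => ⟨hs.1, hs.2.trans_lt ht.2⟩
  have hsub' : ∀ s ∈ Ico a t, s ∈ Ico a b := fun s hs => hsub ⟨hs.1, hs.2.le⟩
  -- The `+ 1` in the bound makes the derivative strictly negative wherever `V` touches it, so `g`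
  -- needs to be positive only, with no lower bound.
  refine image_le_of_deriv_right_lt_deriv_boundary (f' := V')
    (B := fun _ => max (V a) (M / κ + 1)) (B' := fun _ => 0)
    (hcont.mono hsub) (fun s hs => hderiv s (hsub' s hs)) (le_max_left _ _)
    (fun s => hasDerivAt_const _ _) ?_ (right_mem_Icc.2 ht.1)
  intro s hs hV
  refine (hle s (hsub' s hs)).trans_lt (mul_neg_of_pos_of_neg (hg s (hsub' s hs)) ?_)
  have h1 : M / κ + 1 ≤ V s := hV ▸ le_max_right _ _
  have h2 := mul_le_mul_of_nonneg_left h1 hκ.le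
  rw [mul_add, mul_div_cancel₀ _ hκ.ne'] at h2
  linarith

theorem le_of_deriv_right_nonpos {V V' : ℝ → ℝ} {a b : ℝ} (hcont : ContinuousOn V (Ico a b))
    (hderiv : ∀ t ∈ Ico a b, HasDerivWithinAt V (V' t) (Ici t) t)
    (hle : ∀ t ∈ Ico a b, V' t ≤ 0) : ∀ t ∈ Ico a b, V t ≤ V a := by
  intro t ht
  have hsub : Icc a t ⊆ Ico a b := fun s hs => ⟨hs.1, hs.2.trans_lt ht.2⟩
  have hsub' : ∀ s ∈ Ico a t, s ∈ Ico a b := fun s hs => hsub ⟨hs.1, hs.2.le⟩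
  exact image_le_of_deriv_right_le_deriv_boundary (f' := V')
    (B := fun _ => V a) (B' := fun _ => 0)
    (hcont.mono hsub) (fun s hs => hderiv s (hsub' s hs)) le_rfl continuousOn_const
    (fun s _ => hasDerivWithinAt_const _ _ _) (fun s hs => hle s (hsub' s hs))
    (right_mem_Icc.2 ht.1)

/-- If `V` decays at least as fast as the weight `F` grows, then `F V` is bounded by its initial
value. -/
theorem mul_le_of_deriv_right_le {F φ V V' κ : ℝ → ℝ} {a b : ℝ}
    (hFc : ContinuousOn F (Ico a b)) (hVc : ContinuousOn V (Ico a b))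
    (hF : ∀ t ∈ Ico a b, HasDerivWithinAt F (φ t * F t) (Ici t) t)
    (hV : ∀ t ∈ Ico a b, HasDerivWithinAt V (V' t) (Ici t) t)
    (hF0 : ∀ t ∈ Ico a b, 0 ≤ F t) (hV0 : ∀ t ∈ Ico a b, 0 ≤ V t)
    (hle : ∀ t ∈ Ico a b, V' t ≤ -κ t * V t) (hφ : ∀ t ∈ Ico a b, φ t ≤ κ t) :
    ∀ t ∈ Ico a b, F t * V t ≤ F a * V a := by
  refine le_of_deriv_right_nonpos (hFc.mul hVc) (fun t ht => (hF t ht).mul (hV t ht)) ?_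
  intro t ht
  have h1 := mul_le_mul_of_nonneg_left (hle t ht) (hF0 t ht)
  have h2 := mul_le_mul_of_nonneg_right (hφ t ht) (mul_nonneg (hF0 t ht) (hV0 t ht))
  linarith

/-! ### Growth rates of gains along `μ`. -/

section Gain

theorem mu_pos {t0 T t : ℝ} (ht : t < t0 + T) : 0 < mu t0 T t :=
  one_div_pos.2 (by linarith)

theorem le_mu {t0 T t : ℝ} (ht0 : t0 ≤ t) (ht : t < t0 + T) : 1 / T ≤ mu t0 T t :=
  one_div_le_one_div_of_le (by linarith) (by linarith)

/-- The Riccati equation `μ' = μ²` is the source of all factors `s²` in the conditions on the gains.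
-/
theorem hasDerivAt_mu {t0 T t : ℝ} (ht : t < t0 + T) :
    HasDerivAt (mu t0 T) (mu t0 T t ^ 2) t := by
  have h : T + t0 - t ≠ 0 := by linarith
  have h1 : HasDerivAt (fun t => (T + t0 - t)⁻¹) (-(-1) / (T + t0 - t) ^ 2) t :=
    ((hasDerivAt_id t).const_sub (T + t0)).inv h
  refine (h1.congr_deriv ?_).congr_of_eventuallyEq (Eventually.of_forall fun t => ?_)
  · rw [mu]; field_simp
  · simp [mu]

theorem tendsto_mu {t0 T : ℝ} : Tendsto (mu t0 T) (𝓝[<] (t0 + T)) atTop := by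
  have h : Tendsto (fun t => T + t0 - t) (𝓝[<] (t0 + T)) (𝓝[>] 0) := by
    refine tendsto_nhdsWithin_iff.2 ⟨?_, ?_⟩
    · have : ContinuousAt (fun t : ℝ => T + t0 - t) (t0 + T) := by fun_prop
      have h2 := this.tendsto.mono_left (nhdsWithin_le_nhds (s := Iio (t0 + T)))
      simpa [add_comm] using h2
    · filter_upwards [self_mem_nhdsWithin] with t ht
      simp only [mem_Iio] at ht
      simp only [mem_Ioi]
      linarith
  refine (h.inv_tendsto_nhdsGT_zero).congr fun t => ?_
  simp [mu]

/-- The logarithmic derivative `α'(s) s² / α(s)` of `α ∘ μ`, at `s = μ(t)`. -/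
noncomputable def logRate (α : ℝ → ℝ) (s : ℝ) : ℝ := deriv α s * s ^ 2 / α s

namespace ClassKInf

variable {α : ℝ → ℝ}

theorem pos (hα : ClassKInf α) {s : ℝ} (hs : 0 < s) : 0 < α s := by
  rw [← hα.map_zero]
  exact hα.strictMonoOn self_mem_Ici hs.le hs

theorem deriv_nonneg (hα : ClassKInf α) {s : ℝ} (hs : 0 < s) : 0 ≤ deriv α s := by
  rw [← derivWithin_of_mem_nhds (Ici_mem_nhds hs)]
  exact hα.strictMonoOn.monotoneOn.derivWithin_nonneg

theorem logRate_nonneg (hα : ClassKInf α) {s : ℝ} (hs : 0 < s) : 0 ≤ logRate α s :=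
  div_nonneg (mul_nonneg (hα.deriv_nonneg hs) (sq_nonneg _)) (hα.pos hs).le

theorem logRate_le (hα : ClassKInf α) {s κ : ℝ} (hs : 0 < s)
    (h : deriv α s ≤ κ * (s ^ 2)⁻¹ * α s ^ 2) : logRate α s ≤ κ * α s := by
  have h0 := hα.pos hs
  rw [logRate, div_le_iff₀ h0]
  calc deriv α s * s ^ 2 ≤ κ * (s ^ 2)⁻¹ * α s ^ 2 * s ^ 2 := by gcongr
    _ = κ * α s * α s := by field_simp

theorem hasDerivAt_comp_mu (hα : ClassKInf α) (hd : ∀ s, 0 < s → DifferentiableAt ℝ α s)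
    {t0 T t : ℝ} (ht : t < t0 + T) :
    HasDerivAt (fun t => α (mu t0 T t)) (logRate α (mu t0 T t) * α (mu t0 T t)) t := by
  have h := (hd _ (mu_pos ht)).hasDerivAt.comp t (hasDerivAt_mu ht)
  refine h.congr_deriv ?_
  have := (hα.pos (mu_pos ht)).ne'
  rw [logRate]; field_simp

theorem hasDerivAt_comp_mu_pow (hα : ClassKInf α) (hd : ∀ s, 0 < s → DifferentiableAt ℝ α s)
    {t0 T t : ℝ} (ht : t < t0 + T) (k : ℕ) :
    HasDerivAt (fun t => α (mu t0 T t) ^ k)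
      (k * logRate α (mu t0 T t) * α (mu t0 T t) ^ k) t := by
  refine ((hα.hasDerivAt_comp_mu hd ht).fun_pow k).congr_deriv ?_
  cases k with
  | zero => simp
  | succ k => simp only [Nat.add_sub_cancel]; ring

end ClassKInf

end Gain

/-! ### Quadratic forms of positive definite matrices. -/

section Quadratic

variable {ι : Type} [Fintype ι] {A : Matrix ι ι ℝ}

open scoped MatrixOrder in
theorem lamMin_mul_le [DecidableEq ι] (hA : A.PosDef) (x : ι → ℝ) : lamMin A * (x ⬝ᵥ x) ≤ x ⬝ᵥ A *ᵥ x := by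
  have hfin : (spectrum ℝ A).Finite := Matrix.finite_real_spectrum
  have h : algebraMap ℝ (Matrix ι ι ℝ) (lamMin A) ≤ A :=
    (algebraMap_le_iff_le_spectrum hA.1.isSelfAdjoint).2 fun y hy => csInf_le hfin.bddBelow hy
  have h1 := (Matrix.le_iff.1 h).dotProduct_mulVec_nonneg x
  rw [Algebra.algebraMap_eq_smul_one, Matrix.sub_mulVec, Matrix.smul_mulVec, Matrix.one_mulVec,
    dotProduct_sub, dotProduct_smul, star_trivial, smul_eq_mul] at h1
  linarith

open scoped MatrixOrder in
theorem le_lamMax_mul [DecidableEq ι] (hA : A.PosDef) (x : ι → ℝ) : x ⬝ᵥ A *ᵥ x ≤ lamMax A * (x ⬝ᵥ x) := by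
  have hfin : (spectrum ℝ A).Finite := Matrix.finite_real_spectrum
  have h : A ≤ algebraMap ℝ (Matrix ι ι ℝ) (lamMax A) :=
    (le_algebraMap_iff_spectrum_le hA.1.isSelfAdjoint).2 fun y hy => le_csSup hfin.bddAbove hy
  have h1 := (Matrix.le_iff.1 h).dotProduct_mulVec_nonneg x
  rw [Algebra.algebraMap_eq_smul_one, Matrix.sub_mulVec, Matrix.smul_mulVec, Matrix.one_mulVec,
    dotProduct_sub, dotProduct_smul, star_trivial, smul_eq_mul] at h1
  linarith

theorem lamMin_pos [DecidableEq ι] [Nonempty ι] (hA : A.PosDef) : 0 < lamMin A := by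
  have hfin : (spectrum ℝ A).Finite := Matrix.finite_real_spectrum
  have hne : (spectrum ℝ A).Nonempty := by
    rw [hA.1.spectrum_real_eq_range_eigenvalues]
    exact range_nonempty _
  have h := hne.csInf_mem hfin
  rw [hA.1.spectrum_real_eq_range_eigenvalues] at h
  obtain ⟨i, hi⟩ := h
  rw [lamMin, hA.1.spectrum_real_eq_range_eigenvalues, ← hi]
  exact hA.eigenvalues_pos i

theorem lamMin_le_lamMax [DecidableEq ι] [Nonempty ι] (hA : A.PosDef) :
    lamMin A ≤ lamMax A := by
  have hfin : (spectrum ℝ A).Finite := Matrix.finite_real_spectrum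
  have hne : (spectrum ℝ A).Nonempty := by
    rw [hA.1.spectrum_real_eq_range_eigenvalues]
    exact range_nonempty _
  exact csInf_le_csSup hne hfin.bddBelow hfin.bddAbove

theorem dotProduct_mulVec_comm (hA : A.PosDef) (x y : ι → ℝ) : x ⬝ᵥ A *ᵥ y = y ⬝ᵥ A *ᵥ x := by
  have h : Aᵀ = A := by simpa using hA.1.eq
  rw [Matrix.dotProduct_mulVec, ← Matrix.mulVec_transpose, h, dotProduct_comm]

/-- Young's inequality for the bilinear form of a positive definite matrix. -/
theorem two_mul_dotProduct_le (hA : A.PosDef) {ε : ℝ} (hε : 0 < ε) (x y : ι → ℝ) :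
    2 * (x ⬝ᵥ A *ᵥ y) ≤ ε * (x ⬝ᵥ A *ᵥ x) + ε⁻¹ * (y ⬝ᵥ A *ᵥ y) := by
  have h := hA.posSemidef.dotProduct_mulVec_nonneg (ε • x - y)
  rw [star_trivial, Matrix.mulVec_sub, Matrix.mulVec_smul, sub_dotProduct, dotProduct_sub,
    dotProduct_sub, smul_dotProduct, smul_dotProduct, dotProduct_smul, dotProduct_smul,
    dotProduct_mulVec_comm hA y x] at h
  simp only [smul_eq_mul] at h
  have h1 := mul_nonneg (inv_nonneg.2 hε.le) h
  have h2 : ε⁻¹ * (ε * (ε * (x ⬝ᵥ A *ᵥ x)) - ε * (x ⬝ᵥ A *ᵥ y)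
      - (ε * (x ⬝ᵥ A *ᵥ y) - y ⬝ᵥ A *ᵥ y))
      = ε * (x ⬝ᵥ A *ᵥ x) + ε⁻¹ * (y ⬝ᵥ A *ᵥ y) - 2 * (x ⬝ᵥ A *ᵥ y) := by
    field_simp; ring
  rw [h2] at h1
  linarith

end Quadratic

/-! ### The gain `α_s` and the filtered error. -/

namespace Design

variable {r n : ℕ} {D : Design r n}

theorem alphaS_pos (hα : ClassKInf D.alphaX) {s : ℝ} (hs : 0 < s) : 0 < D.alphaS s :=
  mul_pos (pow_pos (hα.pos hs) _) (Real.exp_pos _)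

theorem continuousOn_alphaX_div_sq (hα : ClassKInf D.alphaX) :
    ContinuousOn (fun τ => D.alphaX τ / τ ^ 2) (Ioi 0) :=
  (hα.continuousOn.mono Ioi_subset_Ici_self).div (by fun_prop) fun τ hτ =>
    pow_ne_zero _ (ne_of_gt hτ)

theorem intervalIntegrable_alphaX_div_sq (hα : ClassKInf D.alphaX) {a b : ℝ} (ha : 0 < a)
    (hb : 0 < b) :
    IntervalIntegrable (fun τ => D.alphaX τ / τ ^ 2) MeasureTheory.volume a b := by
  refine ((continuousOn_alphaX_div_sq hα).mono fun τ hτ => ?_).intervalIntegrable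
  exact (lt_min ha hb).trans_le hτ.1

theorem hasDerivAt_alphaS (hα : ClassKInf D.alphaX)
    (hd : ∀ s, 0 < s → DifferentiableAt ℝ D.alphaX s) (h0 : 0 < D.s0) {s : ℝ} (hs : 0 < s) :
    HasDerivAt D.alphaS
      ((((r : ℝ) + 1) * (deriv D.alphaX s / D.alphaX s) + D.v1 / 2 * (D.alphaX s / s ^ 2))
        * D.alphaS s) s := by
  have hc := continuousOn_alphaX_div_sq hα
  have h1 : HasDerivAt (fun u => ∫ τ in D.s0..u, D.alphaX τ / τ ^ 2) (D.alphaX s / s ^ 2) s :=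
    intervalIntegral.integral_hasDerivAt_right (intervalIntegrable_alphaX_div_sq hα h0 hs)
      (hc.stronglyMeasurableAtFilter isOpen_Ioi s hs) (hc.continuousAt (Ioi_mem_nhds hs))
  have h2 := ((hd s hs).hasDerivAt.fun_pow (r + 1)).mul (h1.const_mul (D.v1 / 2)).exp
  refine h2.congr_deriv ?_
  have := (hα.pos hs).ne'
  rw [alphaS]
  push_cast
  rw [pow_succ]
  field_simp

/-- Logarithmic derivative of a product. Together with the bound on `δ_x` it shows `δ_s = O(α_x)`,
which keeps the last term of the controller bounded. -/
theorem deltaS_eq (hα : ClassKInf D.alphaX)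
    (hd : ∀ s, 0 < s → DifferentiableAt ℝ D.alphaX s) (h0 : 0 < D.s0) {s : ℝ} (hs : 0 < s) :
    D.deltaS s = ((r : ℝ) + 1) * D.deltaX s + D.v1 / 2 * D.alphaX s := by
  rw [deltaS, (hasDerivAt_alphaS hα hd h0 hs).deriv, deltaX]
  have h1 := (alphaS_pos hα hs).ne'
  have h2 := (hα.pos hs).ne'
  field_simp

theorem hasDerivAt_alphaS_comp_mu (hα : ClassKInf D.alphaX)
    (hd : ∀ s, 0 < s → DifferentiableAt ℝ D.alphaX s) (h0 : 0 < D.s0) {t0 T t : ℝ}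
    (ht : t < t0 + T) :
    HasDerivAt (fun t => D.alphaS (mu t0 T t))
      (D.deltaS (mu t0 T t) * D.alphaS (mu t0 T t)) t := by
  have hs := hasDerivAt_alphaS hα hd h0 (mu_pos ht)
  have h := hs.comp t (hasDerivAt_mu ht)
  refine h.congr_deriv ?_
  have := (alphaS_pos hα (mu_pos ht)).ne'
  rw [deltaS, hs.deriv]; field_simp

/-- The integrand is nonnegative, so the exponential factor is smallest at `s₁`; its value there is
the constant. -/
theorem exists_mul_pow_le_alphaS (hα : ClassKInf D.alphaX) (h0 : 0 < D.s0) (hv : 0 ≤ D.v1)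
    {s₁ : ℝ} (hs₁ : 0 < s₁) :
    ∃ c > 0, ∀ s, s₁ ≤ s → c * D.alphaX s ^ (r + 1) ≤ D.alphaS s := by
  refine ⟨Real.exp (D.v1 / 2 * ∫ τ in D.s0..s₁, D.alphaX τ / τ ^ 2), Real.exp_pos _,
    fun s hs => ?_⟩
  have hs0 := hs₁.trans_le hs
  rw [alphaS, mul_comm]
  refine mul_le_mul_of_nonneg_left (Real.exp_le_exp.2 ?_) (pow_nonneg (hα.pos hs0).le _)
  refine mul_le_mul_of_nonneg_left ?_ (by linarith)
  rw [← intervalIntegral.integral_add_adjacent_intervals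
    (intervalIntegrable_alphaX_div_sq hα h0 hs₁) (intervalIntegrable_alphaX_div_sq hα hs₁ hs0)]
  have : 0 ≤ ∫ τ in s₁..s, D.alphaX τ / τ ^ 2 :=
    intervalIntegral.integral_nonneg hs fun τ hτ =>
      div_nonneg (hα.pos (hs₁.trans_le hτ.1)).le (sq_nonneg _)
  linarith

variable [NeZero r]

/-- If `k₁ = 0`, the first column of the companion matrix vanishes and zero is an eigenvalue. -/
theorem K_zero_ne_zero (hK : IsHurwitz (companion D.K)) : D.K 0 ≠ 0 := by
  intro h
  have hcol : ∀ i, companion D.K i 0 = 0 := by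
    intro i
    simp [companion, h]
  have hdet : ((companion D.K).map (algebraMap ℝ ℂ)).det = 0 :=
    Matrix.det_eq_zero_of_column_eq_zero 0 fun i => by simp [hcol]
  have hmem : (0 : ℂ) ∈ spectrum ℂ ((companion D.K).map (algebraMap ℝ ℂ)) := by
    rw [spectrum.zero_mem_iff, Matrix.isUnit_iff_isUnit_det, hdet]
    exact not_isUnit_zero
  simpa using hK 0 hmem

theorem sTilde_eq (hK : D.K 0 ≠ 0) (s : ℝ) (x : Fin (r + 1) → E n) (w : E n) :
    D.sTilde s x w = (D.K 0)⁻¹ • (∑ j : Fin r, (D.K j * (D.alphaX s ^ (j : ℕ))⁻¹) • x j.castSucc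
      + (D.alphaX s ^ r)⁻¹ • x (Fin.last r)) - w := by
  have h : ∀ q, Function.update x 0 (x 0 - w) q = x q - (Pi.single 0 w : Fin (r + 1) → E n) q := by
    intro q
    by_cases hq : q = 0
    · subst hq; simp
    · simp [hq]
  have h0 : (Fin.snoc D.K 1 : Fin (r + 1) → ℝ) 0 = D.K 0 := by
    rw [← Fin.castSucc_zero', Fin.snoc_castSucc]
  have h1 : ∑ q : Fin (r + 1), ((Fin.snoc D.K 1 : Fin (r + 1) → ℝ) q * (D.alphaX s ^ (q : ℕ))⁻¹) •
      (Pi.single 0 w : Fin (r + 1) → E n) q = D.K 0 • w := by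
    rw [Finset.sum_eq_single 0 (fun q _ hq => by simp [hq]) (by simp), h0]
    simp
  rw [sTilde]
  simp only [h, smul_sub, Finset.sum_sub_distrib]
  rw [← smul_sub, h1, smul_sub, inv_smul_smul₀ hK, Fin.sum_univ_castSucc]
  simp

theorem B_ne_zero (hK : D.K 0 ≠ 0) (hα : ClassKInf D.alphaX) {s : ℝ} (hs : 0 < s) :
    D.B s ≠ 0 :=
  mul_ne_zero (inv_ne_zero hK) (inv_ne_zero (pow_ne_zero _ (hα.pos hs).ne'))

/-- The term `π` is by design what the moving weights and the lower integrators contribute, measured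
in units of the input; only `w'` stays outside. -/
theorem hasDerivWithinAt_sTilde (hK : D.K 0 ≠ 0) (hα : ClassKInf D.alphaX)
    (hd : ∀ s, 0 < s → DifferentiableAt ℝ D.alphaX s) {t0 T t : ℝ} (ht : t < t0 + T)
    {x : ℝ → Fin (r + 1) → E n} {w : ℝ → E n} {w' y : E n} {S : Set ℝ}
    (hw : HasDerivWithinAt w w' S t)
    (hx : ∀ q : Fin r, HasDerivWithinAt (fun s => x s q.castSucc) (x t q.succ) S t)
    (hxl : HasDerivWithinAt (fun s => x s (Fin.last r)) y S t) :
    HasDerivWithinAt (fun t => D.sTilde (mu t0 T t) (x t) (w t))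
      (D.B (mu t0 T t) • (y + D.piTerm (mu t0 T t) (x t)) - w') S t := by
  simp only [sTilde_eq hK]
  have hb := (hα.pos (mu_pos ht)).ne'
  have hinv : ∀ k : ℕ, HasDerivWithinAt (fun t => (D.alphaX (mu t0 T t) ^ k)⁻¹)
      (-((D.alphaX (mu t0 T t) ^ k)⁻¹ * (k * D.deltaX (mu t0 T t)))) S t := by
    intro k
    have h := ((hα.hasDerivAt_comp_mu_pow hd ht k).inv (pow_ne_zero _ hb)).hasDerivWithinAt (s := S)
    refine h.congr_deriv ?_
    change -(k * D.deltaX (mu t0 T t) * _) / _ = _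
    have := pow_ne_zero k hb
    field_simp
  have h1 := HasDerivWithinAt.fun_sum fun j (_ : j ∈ Finset.univ) =>
    ((hinv (j : Fin r)).const_mul (D.K j)).smul (hx j)
  have h2 := (hinv r).smul hxl
  refine (((h1.add h2).const_smul (D.K 0)⁻¹).sub hw).congr_deriv ?_
  congr 1
  have h3 : (D.alphaX (mu t0 T t) ^ r)⁻¹ * D.alphaX (mu t0 T t) ^ r = 1 :=
    inv_mul_cancel₀ (pow_ne_zero _ hb)
  rw [B, mul_smul]
  congr 1
  rw [piTerm, smul_add, smul_sub, smul_smul, h3, one_smul]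
  have h4 : ∀ j : Fin r, (D.K j * (D.alphaX (mu t0 T t) ^ (j : ℕ))⁻¹) • x t j.succ
      + (D.K j * -((D.alphaX (mu t0 T t) ^ (j : ℕ))⁻¹ * (j * D.deltaX (mu t0 T t))))
        • x t j.castSucc = D.K j • D.r1Dot (mu t0 T t) (x t) j := by
    intro j
    rw [r1Dot]
    module
  simp only [h4]
  module

/-- The dynamics of `ẽ_s` along the closed loop. -/
theorem hasDerivWithinAt_eTilde (hK : D.K 0 ≠ 0) (hα : ClassKInf D.alphaX)
    (hd : ∀ s, 0 < s → DifferentiableAt ℝ D.alphaX s) (h0 : 0 < D.s0) {t0 T t : ℝ}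
    (ht : t < t0 + T)
    {x : ℝ → Fin (r + 1) → E n} {w : ℝ → E n} {w' y : E n} {S : Set ℝ}
    (hw : HasDerivWithinAt w w' S t)
    (hx : ∀ q : Fin r, HasDerivWithinAt (fun s => x s q.castSucc) (x t q.succ) S t)
    (hxl : HasDerivWithinAt (fun s => x s (Fin.last r))
      (D.control (mu t0 T t) (x t) (w t) + y) S t) :
    HasDerivWithinAt (fun t => D.eTilde (mu t0 T t) (x t) (w t))
      (D.alphaS (mu t0 T t) • (D.B (mu t0 T t) • y - w' -
        (|D.B (mu t0 T t)| * (D.v + D.psi (x t) ^ 2 + 1)) •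
          D.eTilde (mu t0 T t) (x t) (w t))) S t := by
  have h := (hasDerivAt_alphaS_comp_mu hα hd h0 ht).hasDerivWithinAt (s := S) |>.smul
    (hasDerivWithinAt_sTilde hK hα hd ht hw hx hxl)
  refine h.congr_deriv ?_
  have hB := B_ne_zero hK hα (mu_pos ht)
  -- The factor `sign(k₁)` in the controller makes the feedback damping whatever the sign of `B`.
  have habs : |D.B (mu t0 T t)| = D.B (mu t0 T t) * Real.sign (D.K 0) := by
    have hb : 0 < (D.alphaX (mu t0 T t) ^ r)⁻¹ := inv_pos.2 (pow_pos (hα.pos (mu_pos ht)) _)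
    rw [B, abs_mul, abs_of_pos hb, abs_inv]
    rcases lt_or_gt_of_ne hK with hneg | hpos
    · rw [abs_of_neg hneg, Real.sign_of_neg hneg, inv_neg]; ring
    · rw [abs_of_pos hpos, Real.sign_of_pos hpos]; ring
  rw [habs, control]
  -- The last term of the controller cancels the growth `δ_s` of the factor `α_s` in `ẽ_s`.
  have h5 : D.B (mu t0 T t) • ((D.B (mu t0 T t))⁻¹ * D.deltaS (mu t0 T t)) •
      D.sTilde (mu t0 T t) (x t) (w t) =
      D.deltaS (mu t0 T t) • D.sTilde (mu t0 T t) (x t) (w t) := by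
    rw [smul_smul, mul_inv_cancel_left₀ hB]
  set X := D.B (mu t0 T t) with hX
  set Y := ((X)⁻¹ * D.deltaS (mu t0 T t)) • D.sTilde (mu t0 T t) (x t) (w t)
  have h6 : X • (-(((D.v + D.psi (x t) ^ 2 + 1) * (D.K 0).sign) •
      D.eTilde (mu t0 T t) (x t) (w t)) - D.piTerm (mu t0 T t) (x t) - Y + y
        + D.piTerm (mu t0 T t) (x t)) =
      X • (y - ((D.v + D.psi (x t) ^ 2 + 1) * (D.K 0).sign) • D.eTilde (mu t0 T t) (x t) (w t))
        - X • Y := by module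
  rw [h6, h5]
  module

/-- Boundedness of `ẽ_s`. -/
theorem exists_norm_eTilde_le (hK : D.K 0 ≠ 0) (hα : ClassKInf D.alphaX)
    (hd : ∀ s, 0 < s → DifferentiableAt ℝ D.alphaX s) (h0 : 0 < D.s0) (hv : 0 < D.v)
    {t0 T t1 : ℝ} (ht1 : t1 ≤ t0 + T)
    {x : ℝ → Fin (r + 1) → E n} {w w' y : ℝ → E n}
    (hwc : ContinuousOn w (Ico t0 t1)) (hxc : ContinuousOn x (Ico t0 t1))
    (hw : ∀ t ∈ Ico t0 t1, HasDerivWithinAt w (w' t) (Ici t) t)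
    (hx : ∀ t ∈ Ico t0 t1, ∀ q : Fin r,
      HasDerivWithinAt (fun s => x s q.castSucc) (x t q.succ) (Ici t) t)
    (hxl : ∀ t ∈ Ico t0 t1, HasDerivWithinAt (fun s => x s (Fin.last r))
      (D.control (mu t0 T t) (x t) (w t) + y t) (Ici t) t)
    {H M : ℝ} (hy : ∀ t ∈ Ico t0 t1, ‖y t‖ ≤ H * D.psi (x t))
    (hM : ∀ t ∈ Ico t0 t1, D.alphaX (mu t0 T t) ^ r * ‖w' t‖ ≤ M) :
    ∃ C, ∀ t ∈ Ico t0 t1, ‖D.eTilde (mu t0 T t) (x t) (w t)‖ ≤ C := by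
  have hlt : ∀ t ∈ Ico t0 t1, t < t0 + T := fun t ht => ht.2.trans_le ht1
  have hbc : ContinuousOn (fun t => D.alphaX (mu t0 T t)) (Ico t0 t1) := fun t ht =>
    (hα.hasDerivAt_comp_mu hd (hlt t ht)).continuousAt.continuousWithinAt
  have hsc : ContinuousOn (fun t => D.alphaS (mu t0 T t)) (Ico t0 t1) := fun t ht =>
    (hasDerivAt_alphaS_comp_mu hα hd h0 (hlt t ht)).continuousAt.continuousWithinAt
  have hbne : ∀ t ∈ Ico t0 t1, ∀ k : ℕ, D.alphaX (mu t0 T t) ^ k ≠ 0 := fun t ht k =>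
    pow_ne_zero _ (hα.pos (mu_pos (hlt t ht))).ne'
  have hec : ContinuousOn (fun t => D.eTilde (mu t0 T t) (x t) (w t)) (Ico t0 t1) := by
    simp only [eTilde, sTilde_eq hK]
    have hxq : ∀ q, ContinuousOn (fun t => x t q) (Ico t0 t1) := fun q =>
      (continuous_apply q).comp_continuousOn hxc
    refine hsc.fun_smul (ContinuousOn.fun_sub (continuousOn_const.fun_smul (ContinuousOn.fun_add
      (continuousOn_finsetSum _ fun j _ => ?_) ?_)) hwc)
    · exact (continuousOn_const.mul ((hbc.pow _).inv₀ fun t ht => hbne t ht _)).smul (hxq _)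
    · exact ((hbc.pow _).inv₀ fun t ht => hbne t ht _).smul (hxq _)
  have key := le_max_of_deriv_right_le (κ := D.v)
    (V := fun t => ‖D.eTilde (mu t0 T t) (x t) (w t)‖ ^ 2)
    (g := fun t => 2 * (D.alphaS (mu t0 T t) * |D.B (mu t0 T t)|))
    (M := H ^ 2 / 4 + (|D.K 0| * M) ^ 2 / 4) hv (hec.norm.pow 2)
    (fun t ht => (hasDerivWithinAt_eTilde hK hα hd h0 (hlt t ht) (hw t ht) (hx t ht)
      (hxl t ht)).norm_sq) ?_ ?_
  · refine ⟨Real.sqrt _, fun t ht => Real.le_sqrt_of_sq_le (key t ht)⟩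
  · intro t ht
    have h1 := alphaS_pos hα (mu_pos (hlt t ht))
    have h2 := abs_pos.2 (B_ne_zero hK hα (mu_pos (hlt t ht)))
    positivity
  · intro t ht
    have h1 := alphaS_pos hα (mu_pos (hlt t ht))
    have hbp : 0 < D.alphaX (mu t0 T t) ^ r := pow_pos (hα.pos (mu_pos (hlt t ht))) r
    have h2 := abs_pos.2 (B_ne_zero hK hα (mu_pos (hlt t ht)))
    -- The derivative of the reference is not cancelled but is of order `|B|`, because `|B| |k₁|
    -- α_x^r = 1`.
    have hw'B : ‖w' t‖ ≤ |D.B (mu t0 T t)| * (|D.K 0| * M) := by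
      have h3 : |D.B (mu t0 T t)| * |D.K 0| * D.alphaX (mu t0 T t) ^ r = 1 := by
        rw [B, abs_mul, abs_inv, abs_of_pos (inv_pos.2 hbp)]
        have := abs_pos.2 hK
        field_simp
      calc ‖w' t‖ = |D.B (mu t0 T t)| * |D.K 0| * D.alphaX (mu t0 T t) ^ r * ‖w' t‖ := by
            rw [h3, one_mul]
        _ = |D.B (mu t0 T t)| * (|D.K 0| * (D.alphaX (mu t0 T t) ^ r * ‖w' t‖)) := by ring
        _ ≤ _ := by gcongr; exact hM t ht
    set e := D.eTilde (mu t0 T t) (x t) (w t)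
    set β := |D.B (mu t0 T t)| with hβ
    have hyn := hy t ht
    set ψ := D.psi (x t)
    rw [inner_smul_right, inner_sub_right, inner_sub_right, inner_smul_right, inner_smul_right,
      real_inner_self_eq_norm_sq]
    have hi1 : D.B (mu t0 T t) * inner ℝ e (y t) ≤ β * (‖e‖ * (H * ψ)) := by
      refine (le_abs_self _).trans ?_
      rw [abs_mul, ← hβ]
      refine mul_le_mul_of_nonneg_left ((abs_real_inner_le_norm _ _).trans ?_) h2.le
      exact mul_le_mul_of_nonneg_left hyn (norm_nonneg _)
    have hi2 : -inner ℝ e (w' t) ≤ β * (‖e‖ * (|D.K 0| * M)) := by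
      refine (neg_le_abs _).trans ((abs_real_inner_le_norm _ _).trans ?_)
      calc ‖e‖ * ‖w' t‖ ≤ ‖e‖ * (β * (|D.K 0| * M)) :=
            mul_le_mul_of_nonneg_left hw'B (norm_nonneg _)
        _ = _ := by ring
    -- Two completed squares: `ψ²` dominates the uncertainty with its unknown factor `H`, the `1`
    -- dominates the reference, and `v` remains as decay.
    have hq : ‖e‖ * (H * ψ) + ‖e‖ * (|D.K 0| * M) - (D.v + ψ ^ 2 + 1) * ‖e‖ ^ 2
        ≤ H ^ 2 / 4 + (|D.K 0| * M) ^ 2 / 4 - D.v * ‖e‖ ^ 2 := by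
      nlinarith [sq_nonneg (‖e‖ * ψ - H / 2), sq_nonneg (‖e‖ - |D.K 0| * M / 2)]
    calc 2 * (D.alphaS (mu t0 T t) * (D.B (mu t0 T t) * inner ℝ e (y t) - inner ℝ e (w' t)
          - β * (D.v + ψ ^ 2 + 1) * ‖e‖ ^ 2))
        ≤ 2 * (D.alphaS (mu t0 T t) * (β * (‖e‖ * (H * ψ) + ‖e‖ * (|D.K 0| * M)
          - (D.v + ψ ^ 2 + 1) * ‖e‖ ^ 2))) := by gcongr; linarith
      _ ≤ 2 * (D.alphaS (mu t0 T t) * (β * (H ^ 2 / 4 + (|D.K 0| * M) ^ 2 / 4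
          - D.v * ‖e‖ ^ 2))) := by gcongr
      _ = _ := by ring

end Design

/-! ### Lyapunov estimate for the scaled chain. -/

namespace Design

variable {r n : ℕ} {D : Design r n}

theorem v1_pos [NeZero r] (hn : 1 ≤ n) (hP : D.P.PosDef) (hQ : D.Q.PosDef) : 0 < D.v1 := by
  have : NeZero n := ⟨by omega⟩
  exact mul_pos (lamMin_pos hQ) (inv_pos.2 ((lamMin_pos hP).trans_le (lamMin_le_lamMax hP)))

theorem le_v2 [NeZero r] (hn : 1 ≤ n) (hP : D.P.PosDef) : 2 * ((r : ℝ) + 1) ≤ D.v2 := by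
  have : NeZero n := ⟨by omega⟩
  have h := lamMin_pos hP
  rw [v2, mul_assoc]
  refine le_mul_of_one_le_right (by positivity) ?_
  rw [← div_eq_mul_inv, one_le_div h]
  exact lamMin_le_lamMax hP

/-- Dissipation of the quadratic form of `P` along the scaled chain of integrators, in which the
`j`-th block carries the weight `α_x(μ)^{m-j}`. -/
theorem chain_dissipation [NeZero r] (hn : 1 ≤ n) (hP : D.P.PosDef) (hQ : D.Q.PosDef)
    (hlyap : D.P * (companion D.K ⊗ₖ (1 : Matrix (Fin n) (Fin n) ℝ))
      + ((companion D.K)ᵀ ⊗ₖ (1 : Matrix (Fin n) (Fin n) ℝ)) * D.P = -D.Q)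
    {b δ M : ℝ} (hb : 0 < b) (hδ : 0 ≤ δ) (hδb : δ ≤ D.v1 / (2 * D.v2) * b)
    {X Y X' : Fin r × Fin n → ℝ}
    (hX' : ∀ a, X' a = ((r : ℝ) + 1 - (a.1 : ℕ)) * δ * X a +
      b * (((companion D.K ⊗ₖ (1 : Matrix (Fin n) (Fin n) ℝ)) *ᵥ X) a + Y a))
    (hY : Y ⬝ᵥ Y ≤ M) :
    2 * (X ⬝ᵥ D.P *ᵥ X') ≤
      b * ((D.v1 / (4 * ((r : ℝ) + 1)))⁻¹ * (lamMax D.P * M)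
        - D.v1 / (4 * ((r : ℝ) + 1)) * (X ⬝ᵥ D.P *ᵥ X)) := by
  have : NeZero n := ⟨by omega⟩
  have hr : (0 : ℝ) < r := Nat.cast_pos.2 (Nat.pos_of_ne_zero (NeZero.ne r))
  set Λ := companion D.K ⊗ₖ (1 : Matrix (Fin n) (Fin n) ℝ) with hΛ
  have hlow := lamMin_pos hP
  have hle := lamMin_le_lamMax hP
  have hup : 0 < lamMax D.P := hlow.trans_le hle
  have hv1 : 0 < D.v1 := v1_pos hn hP hQ
  set W := X ⬝ᵥ D.P *ᵥ X with hW
  have hXX : 0 ≤ X ⬝ᵥ X := Finset.sum_nonneg fun a _ => mul_self_nonneg _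
  have hW0 : 0 ≤ W := (mul_nonneg hlow.le hXX).trans (lamMin_mul_le hP X)
  -- The weights `r + 1 - j` differ between blocks and need not commute with `P`; the part depending
  -- on `j` is isolated here and bounded through the condition number `κ` of `P`.
  set Z : Fin r × Fin n → ℝ := fun a => (a.1 : ℕ) * X a with hZ
  have hX'eq : X' = ((r + 1) * δ) • X - δ • Z + b • (Λ *ᵥ X) + b • Y := by
    funext a
    simp only [hX', hZ, Pi.add_apply, Pi.sub_apply, Pi.smul_apply, smul_eq_mul]
    ring
  have hΛX : 2 * (X ⬝ᵥ D.P *ᵥ (Λ *ᵥ X)) = -(X ⬝ᵥ D.Q *ᵥ X) := by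
    have h1 : X ⬝ᵥ Λᵀ *ᵥ (D.P *ᵥ X) = X ⬝ᵥ D.P *ᵥ (Λ *ᵥ X) := by
      rw [Matrix.dotProduct_mulVec, Matrix.vecMul_transpose,
        dotProduct_mulVec_comm hP]
    have h2 : Λᵀ = (companion D.K)ᵀ ⊗ₖ (1 : Matrix (Fin n) (Fin n) ℝ) := by
      rw [hΛ, ← Matrix.kroneckerMap_transpose, Matrix.transpose_one]
    have h3 := congrArg (fun A => X ⬝ᵥ A *ᵥ X) hlyap
    simp only [← h2, Matrix.add_mulVec, dotProduct_add, h1, Matrix.neg_mulVec,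
      dotProduct_neg, ← Matrix.mulVec_mulVec] at h3
    rw [← h3]; ring
  have hQX : D.v1 * W ≤ X ⬝ᵥ D.Q *ᵥ X := by
    refine le_trans ?_ (lamMin_mul_le hQ X)
    rw [v1, mul_assoc]
    refine mul_le_mul_of_nonneg_left ?_ (lamMin_pos hQ).le
    rw [inv_mul_eq_div, div_le_iff₀ hup, mul_comm]
    exact le_lamMax_mul hP X
  set κ := lamMax D.P * (lamMin D.P)⁻¹ with hκ
  have hκ1 : 1 ≤ κ := by
    rw [hκ, ← div_eq_mul_inv, one_le_div hlow]; exact hle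
  have hZX : -(2 * (X ⬝ᵥ D.P *ᵥ Z)) ≤ 2 * r * κ * W := by
    have h1 := two_mul_dotProduct_le hP hr X (-Z)
    have h2 : Z ⬝ᵥ D.P *ᵥ Z ≤ r ^ 2 * (κ * W) := by
      have h3 : Z ⬝ᵥ Z ≤ r ^ 2 * (X ⬝ᵥ X) := by
        simp only [dotProduct, Finset.mul_sum, hZ]
        refine Finset.sum_le_sum fun a _ => ?_
        have h4 : ((a.1 : ℕ) : ℝ) ^ 2 ≤ (r : ℝ) ^ 2 := by
          gcongr; exact_mod_cast a.1.2.le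
        nlinarith [mul_le_mul_of_nonneg_right h4 (mul_self_nonneg (X a))]
      have h5 : X ⬝ᵥ X ≤ (lamMin D.P)⁻¹ * W := by
        rw [inv_mul_eq_div, le_div_iff₀ hlow, mul_comm]
        exact lamMin_mul_le hP X
      calc Z ⬝ᵥ D.P *ᵥ Z ≤ lamMax D.P * (Z ⬝ᵥ Z) := le_lamMax_mul hP Z
        _ ≤ lamMax D.P * (r ^ 2 * ((lamMin D.P)⁻¹ * W)) := by gcongr; exact h3.trans (by gcongr)
        _ = r ^ 2 * (κ * W) := by rw [hκ]; ring
    simp only [Matrix.mulVec_neg, dotProduct_neg, neg_dotProduct, neg_neg] at h1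
    have h6 : (r : ℝ)⁻¹ * (Z ⬝ᵥ D.P *ᵥ Z) ≤ r * (κ * W) := by
      rw [inv_mul_eq_div, div_le_iff₀ hr]
      linarith
    nlinarith [mul_le_mul_of_nonneg_right hκ1 (mul_nonneg hr.le hW0)]
  have hε : 0 < D.v1 / (4 * ((r : ℝ) + 1)) := by positivity
  -- In units of `ε b W`, the uniform weights cost `2(r+1)`, the `Z` part `2r`, Young's inequality
  -- `1`, while `Q` yields `4(r+1)`. Exactly one unit of decay is left.
  set ε := D.v1 / (4 * ((r : ℝ) + 1)) with hεdef
  have hYX : 2 * (X ⬝ᵥ D.P *ᵥ Y) ≤ ε * W + ε⁻¹ * (lamMax D.P * M) := by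
    refine (two_mul_dotProduct_le hP hε X Y).trans ?_
    have := (le_lamMax_mul hP Y).trans (mul_le_mul_of_nonneg_left hY hup.le)
    gcongr
  have hεv : 4 * ((r : ℝ) + 1) * ε = D.v1 := by rw [hεdef]; field_simp
  have hκδ : κ * δ ≤ ε * b := by
    have h1 : D.v1 / (2 * D.v2) * κ = ε := by
      have hv2 : D.v2 = 2 * ((r : ℝ) + 1) * κ := by rw [v2, hκ]; ring
      have : κ ≠ 0 := by positivity
      rw [hv2, hεdef]; field_simp; norm_num
    calc κ * δ ≤ κ * (D.v1 / (2 * D.v2) * b) := by gcongr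
      _ = ε * b := by rw [← h1]; ring
  have hδ1 : δ ≤ κ * δ := le_mul_of_one_le_left hδ hκ1
  have hexp : 2 * (X ⬝ᵥ D.P *ᵥ X') = 2 * ((r + 1) * δ) * W + δ * -(2 * (X ⬝ᵥ D.P *ᵥ Z))
      + b * (2 * (X ⬝ᵥ D.P *ᵥ (Λ *ᵥ X))) + b * (2 * (X ⬝ᵥ D.P *ᵥ Y)) := by
    rw [hX'eq]
    simp only [Matrix.mulVec_add, Matrix.mulVec_sub, Matrix.mulVec_smul, dotProduct_add,
      dotProduct_sub, dotProduct_smul, smul_eq_mul]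
    ring
  rw [hexp, hΛX]
  have e1 := mul_le_mul_of_nonneg_left hZX hδ
  have e2 := mul_le_mul_of_nonneg_left hQX hb.le
  have e3 := mul_le_mul_of_nonneg_left hYX hb.le
  have e4 := mul_le_mul_of_nonneg_right hκδ (mul_nonneg hr.le hW0)
  have e5 := mul_le_mul_of_nonneg_right (hδ1.trans hκδ) (mul_nonneg (by linarith : (0 : ℝ) ≤ r + 1) hW0)
  rw [← hεv] at e2
  nlinarith [mul_nonneg hb.le (mul_nonneg hε.le hW0)]

end Design

/-! ### Scaled errors of one agent. -/

namespace Design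

variable {r n : ℕ} {D : Design r n} {alpha : ℝ → ℝ} {cst : ℝ}

/-- The scaled errors `α_x(s)^{m-q} (x_q - [q = 0] z)`, with indices starting at `0`. -/
noncomputable def scaledError (D : Design r n) (s : ℝ) (z : E n) (x : Fin (r + 1) → E n)
    (q : Fin (r + 1)) : E n :=
  D.alphaX s ^ (r + 1 - (q : ℕ)) • (x q - if q = 0 then z else 0)

theorem scaledError_succ (s : ℝ) (z : E n) (x : Fin (r + 1) → E n) (j : Fin r) :
    D.scaledError s z x j.succ = D.alphaX s ^ (r - (j : ℕ)) • x j.succ := by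
  rw [scaledError, if_neg (Fin.succ_ne_zero j), sub_zero, Fin.val_succ, Nat.add_sub_add_right]

theorem scaledError_last [NeZero r] (s : ℝ) (z : E n) (x : Fin (r + 1) → E n) :
    D.scaledError s z x (Fin.last r) = D.alphaX s • x (Fin.last r) := by
  have : Fin.last r ≠ 0 := by simp [Fin.ext_iff, NeZero.ne r]
  rw [scaledError, if_neg this, sub_zero, Fin.val_last, Nat.add_sub_cancel_left, pow_one]

/-- The factor `q` kills the only entry shifted by `z`. Hence `π`, which does not know `z`, is still
expressible through the errors. -/
theorem natCast_smul_scaledError (s : ℝ) (z : E n) (x : Fin (r + 1) → E n) (q : Fin (r + 1)) :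
    ((q : ℕ) : ℝ) • D.scaledError s z x q
      = (((q : ℕ) : ℝ) * D.alphaX s ^ (r + 1 - (q : ℕ))) • x q := by
  by_cases hq : q = 0
  · subst hq; simp
  · rw [scaledError, if_neg hq, sub_zero, smul_smul]

/-- This relation closes the chain: it expresses the last error by companion feedback plus a forcing
made of `s̃` and the reference error. -/
theorem sum_smul_scaledError [NeZero r] (hK : D.K 0 ≠ 0) {s : ℝ} (hs : D.alphaX s ≠ 0) (z w : E n)
    (x : Fin (r + 1) → E n) :
    ∑ j : Fin r, D.K j • D.scaledError s z x j.castSucc + D.scaledError s z x (Fin.last r)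
      = D.K 0 • D.alphaX s ^ (r + 1) • (D.sTilde s x w + (w - z)) := by
  have h1 : ∑ j : Fin r, D.K j • D.scaledError s z x j.castSucc
      = D.alphaX s ^ (r + 1) • ∑ j : Fin r, (D.K j * (D.alphaX s ^ (j : ℕ))⁻¹) • x j.castSucc
        - D.K 0 • D.alphaX s ^ (r + 1) • z := by
    have h2 : ∑ j : Fin r, (D.K j * D.alphaX s ^ (r + 1 - (j : ℕ))) •
        (if j = 0 then z else 0) = D.K 0 • D.alphaX s ^ (r + 1) • z := by
      rw [Finset.sum_eq_single 0 (fun j _ hj => by simp [hj]) (by simp)]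
      simp [smul_smul]
    rw [← h2, Finset.smul_sum, ← Finset.sum_sub_distrib]
    refine Finset.sum_congr rfl fun j _ => ?_
    have h3 : D.alphaX s ^ (r + 1) = D.alphaX s ^ (r + 1 - (j : ℕ)) * D.alphaX s ^ (j : ℕ) := by
      rw [← pow_add, Nat.sub_add_cancel (by omega)]
    have h4 : D.alphaX s ^ (r + 1) * (D.K j * (D.alphaX s ^ (j : ℕ))⁻¹)
        = D.K j * D.alphaX s ^ (r + 1 - (j : ℕ)) := by
      rw [h3]
      have := pow_ne_zero (j : ℕ) hs
      field_simp
    simp only [scaledError, Fin.val_castSucc, smul_smul, h4, smul_sub, Fin.castSucc_eq_zero_iff]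
  have h5 : D.alphaX s ^ (r + 1) • (D.alphaX s ^ r)⁻¹ • x (Fin.last r)
      = D.alphaX s • x (Fin.last r) := by
    rw [smul_smul, pow_succ']
    have := pow_ne_zero r hs
    rw [mul_assoc, mul_inv_cancel₀ this, mul_one]
  rw [h1, scaledError_last, sTilde_eq hK, ← h5]
  have h6 : ∀ S : E n, D.K 0 • D.alphaX s ^ (r + 1) • ((D.K 0)⁻¹ • S - w + (w - z))
      = D.alphaX s ^ (r + 1) • S - D.K 0 • D.alphaX s ^ (r + 1) • z := by
    intro S
    rw [sub_add_sub_cancel, smul_sub, smul_sub, smul_comm (D.K 0), smul_inv_smul₀ hK]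
  rw [h6]
  module

/-- All powers of `α_x` are absorbed by the errors; only the ratio `δ_x / α_x`, bounded by the
growth condition, remains. -/
theorem piTerm_eq {s : ℝ} (hs : D.alphaX s ≠ 0) (z : E n) (x : Fin (r + 1) → E n) [NeZero r] :
    D.piTerm s x = ∑ j : Fin r, D.K j • (D.scaledError s z x j.succ
        - ((j : ℕ) * (D.deltaX s / D.alphaX s)) • D.scaledError s z x j.castSucc)
      - (r * (D.deltaX s / D.alphaX s)) • D.scaledError s z x (Fin.last r) := by
  have h1 : ((r : ℝ) * D.deltaX s) • x (Fin.last r)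
      = (r * (D.deltaX s / D.alphaX s)) • D.scaledError s z x (Fin.last r) := by
    rw [scaledError_last, smul_smul]
    congr 1; field_simp
  rw [piTerm, h1, Finset.smul_sum]
  congr 1
  refine Finset.sum_congr rfl fun j _ => ?_
  have h2 := natCast_smul_scaledError (D := D) s z x j.castSucc
  rw [Fin.val_castSucc] at h2
  have h3 : D.alphaX s ^ (r + 1 - (j : ℕ)) = D.alphaX s ^ (r - (j : ℕ)) * D.alphaX s := by
    rw [← pow_succ]; congr 1; omega
  have h4 : D.alphaX s ^ r * (D.alphaX s ^ (j : ℕ))⁻¹ = D.alphaX s ^ (r - (j : ℕ)) := by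
    rw [← div_eq_mul_inv, div_eq_iff (pow_ne_zero _ hs), ← pow_add, Nat.sub_add_cancel j.2.le]
  have h5 : (((j : ℕ) : ℝ) * (D.deltaX s / D.alphaX s)) • D.scaledError s z x j.castSucc
      = D.alphaX s ^ (r - (j : ℕ)) • (((j : ℕ) : ℝ) * D.deltaX s) • x j.castSucc := by
    rw [mul_comm, mul_smul, h2, h3, smul_smul, smul_smul]
    congr 1; field_simp
  rw [smul_comm, r1Dot, smul_smul (D.alphaX s ^ r), h4, scaledError_succ, h5, smul_sub]

theorem hasDerivWithinAt_scaledError (hα : ClassKInf D.alphaX)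
    (hd : ∀ s, 0 < s → DifferentiableAt ℝ D.alphaX s) {t0 T t : ℝ} (ht : t < t0 + T) (z : E n)
    {x : ℝ → Fin (r + 1) → E n} {S : Set ℝ} (j : Fin r)
    (hx : HasDerivWithinAt (fun s => x s j.castSucc) (x t j.succ) S t) :
    HasDerivWithinAt (fun t => D.scaledError (mu t0 T t) z (x t) j.castSucc)
      ((((r : ℝ) + 1 - (j : ℕ)) * D.deltaX (mu t0 T t)) •
          D.scaledError (mu t0 T t) z (x t) j.castSucc
        + D.alphaX (mu t0 T t) • D.scaledError (mu t0 T t) z (x t) j.succ) S t := by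
  have h := (hα.hasDerivAt_comp_mu_pow hd ht (r + 1 - (j : ℕ))).hasDerivWithinAt (s := S)
    |>.smul (hx.sub_const (if j.castSucc = 0 then z else 0))
  refine h.congr_deriv ?_
  have h3 : D.alphaX (mu t0 T t) ^ (r + 1 - (j : ℕ))
      = D.alphaX (mu t0 T t) * D.alphaX (mu t0 T t) ^ (r - (j : ℕ)) := by
    rw [← pow_succ']; congr 1; omega
  rw [scaledError_succ, smul_smul, ← h3, add_comm, scaledError, smul_smul, Fin.val_castSucc]
  congr 2
  have h4 : ((r + 1 - (j : ℕ) : ℕ) : ℝ) = (r : ℝ) + 1 - (j : ℕ) := by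
    rw [Nat.cast_sub (by omega)]; push_cast; ring
  rw [h4]; rfl

theorem companion_kronecker_mulVec (K : Fin r → ℝ) (X : Fin r × Fin n → ℝ) (j : Fin r)
    (k : Fin n) :
    ((companion K ⊗ₖ (1 : Matrix (Fin n) (Fin n) ℝ)) *ᵥ X) (j, k)
      = ∑ i, companion K j i * X (i, k) := by
  simp [Matrix.mulVec, dotProduct, Fintype.sum_prod_type, Matrix.kroneckerMap_apply,
    Matrix.one_apply, mul_ite, ite_mul]

/-- The scaled errors are bounded as soon as `α_x(μ)^m (s̃ + ϖ - z)` is. -/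
theorem exists_norm_scaledError_le [NeZero r] (hn : 1 ≤ n) (hD : D.Admissible alpha cst)
    {t0 T t1 : ℝ} (ht1 : t1 ≤ t0 + T)
    {x : ℝ → Fin (r + 1) → E n} {w : ℝ → E n} {z : E n}
    (hxc : ContinuousOn x (Ico t0 t1))
    (hx : ∀ t ∈ Ico t0 t1, ∀ q : Fin r,
      HasDerivWithinAt (fun s => x s q.castSucc) (x t q.succ) (Ici t) t)
    {L : ℝ} (hL : ∀ t ∈ Ico t0 t1, D.alphaX (mu t0 T t) ^ (r + 1) *
      ‖D.sTilde (mu t0 T t) (x t) (w t) + (w t - z)‖ ≤ L) :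
    ∃ C, ∀ t ∈ Ico t0 t1, ∀ q, ‖D.scaledError (mu t0 T t) z (x t) q‖ ≤ C := by
  have hα := hD.alphaX_class
  have hd := hD.alphaX_diff
  have hK : D.K 0 ≠ 0 := K_zero_ne_zero hD.hurwitz
  have hlt : ∀ t ∈ Ico t0 t1, t < t0 + T := fun t ht => ht.2.trans_le ht1
  have hv1 := v1_pos hn hD.posDef_P hD.posDef_Q
  have : NeZero n := ⟨by omega⟩
  set ξ : ℝ → Fin (r + 1) → E n := fun t q => D.scaledError (mu t0 T t) z (x t) q with hξ
  set g : ℝ → E n := fun t => D.K 0 • D.alphaX (mu t0 T t) ^ (r + 1) •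
    (D.sTilde (mu t0 T t) (x t) (w t) + (w t - z)) with hg
  have hgL : ∀ t ∈ Ico t0 t1, ‖g t‖ ≤ |D.K 0| * L := by
    intro t ht
    rw [hg]
    simp only
    rw [norm_smul, norm_smul, Real.norm_eq_abs, Real.norm_eq_abs,
      abs_of_pos (pow_pos (hα.pos (mu_pos (hlt t ht))) _)]
    exact mul_le_mul_of_nonneg_left (hL t ht) (abs_nonneg _)
  have hrel : ∀ t ∈ Ico t0 t1, ∑ j : Fin r, D.K j • ξ t j.castSucc + ξ t (Fin.last r) = g t :=
    fun t ht => sum_smul_scaledError hK (hα.pos (mu_pos (hlt t ht))).ne' z (w t) (x t)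
  set X : ℝ → Fin r × Fin n → ℝ := fun t a => ξ t a.1.castSucc a.2 with hX
  set Y : ℝ → Fin r × Fin n → ℝ := fun t a => if (a.1 : ℕ) + 1 = r then g t a.2 else 0 with hY
  set X' : ℝ → Fin r × Fin n → ℝ := fun t a =>
    ((r : ℝ) + 1 - (a.1 : ℕ)) * D.deltaX (mu t0 T t) * X t a + D.alphaX (mu t0 T t) *
      (((companion D.K ⊗ₖ (1 : Matrix (Fin n) (Fin n) ℝ)) *ᵥ X t) a + Y t a) with hX'
  -- Upper rows of the companion matrix are shifts; the last row is the relation `hrel`, whose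
  -- right-hand side is the only forcing.
  have hchain : ∀ t ∈ Ico t0 t1, ∀ a, ξ t a.1.succ a.2
      = ((companion D.K ⊗ₖ (1 : Matrix (Fin n) (Fin n) ℝ)) *ᵥ X t) a + Y t a := by
    rintro t ht ⟨j, k⟩
    rw [companion_kronecker_mulVec]
    simp only [hY, companion, Matrix.of_apply, hX]
    by_cases hj : (j : ℕ) + 1 = r
    · have hj' : j.succ = Fin.last r := Fin.ext (by simpa using hj)
      have h1 := congrArg (fun u : E n => u k) (hrel t ht)
      simp only [PiLp.add_apply, WithLp.ofLp_sum, Finset.sum_apply, PiLp.smul_apply,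
        smul_eq_mul] at h1
      simp only [hj, if_true, hj', neg_mul, Finset.sum_neg_distrib]
      linarith
    · have hj' : (j : ℕ) + 1 < r := lt_of_le_of_ne j.2 hj
      simp only [hj, if_false, add_zero, ite_mul, one_mul, zero_mul]
      rw [Finset.sum_eq_single ⟨(j : ℕ) + 1, hj'⟩]
      · simp only [if_true]; rfl
      · intro i _ hi
        rw [if_neg]
        exact fun h => hi (Fin.ext h)
      · simp
  have hXd : ∀ t ∈ Ico t0 t1, ∀ a, HasDerivWithinAt (fun t => X t a) (X' t a) (Ici t) t := by
    intro t ht a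
    have h1 := hasDerivWithinAt_scaledError hα hd (hlt t ht) z a.1 (hx t ht a.1)
    have h2 := (EuclideanSpace.proj (𝕜 := ℝ) a.2).hasFDerivAt.comp_hasDerivWithinAt t h1
    refine h2.congr_deriv ?_
    simp only [hX', ← hchain t ht a]
    simp [hX, hξ]
  have hbc : ContinuousOn (fun t => D.alphaX (mu t0 T t)) (Ico t0 t1) := fun t ht =>
    (hα.hasDerivAt_comp_mu hd (hlt t ht)).continuousAt.continuousWithinAt
  have hXc : ∀ a, ContinuousOn (fun t => X t a) (Ico t0 t1) := by
    intro a
    have h1 : ContinuousOn (fun t => ξ t a.1.castSucc) (Ico t0 t1) :=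
      (hbc.pow _).fun_smul (((continuous_apply _).comp_continuousOn hxc).fun_sub continuousOn_const)
    exact (EuclideanSpace.proj (𝕜 := ℝ) a.2).continuous.comp_continuousOn h1
  have hYg : ∀ t ∈ Ico t0 t1, Y t ⬝ᵥ Y t ≤ r * (|D.K 0| * L) ^ 2 := by
    intro t ht
    have h1 : Y t ⬝ᵥ Y t ≤ ∑ _j : Fin r, ‖g t‖ ^ 2 := by
      rw [dotProduct, Fintype.sum_prod_type]
      refine Finset.sum_le_sum fun j _ => ?_
      rw [EuclideanSpace.real_norm_sq_eq]
      refine Finset.sum_le_sum fun k _ => ?_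
      simp only [hY]
      split_ifs
      · rw [sq]
      · rw [mul_zero]; exact sq_nonneg _
    rw [Finset.sum_const, Finset.card_univ, Fintype.card_fin, nsmul_eq_mul] at h1
    refine h1.trans ?_
    have := hgL t ht
    gcongr
  set U : ℝ → ℝ := fun t => X t ⬝ᵥ D.P *ᵥ X t with hU
  have hUd : ∀ t ∈ Ico t0 t1,
      HasDerivWithinAt U (2 * (X t ⬝ᵥ D.P *ᵥ X' t)) (Ici t) t := by
    intro t ht
    have h1 := HasDerivWithinAt.fun_sum fun a (_ : a ∈ Finset.univ) => (hXd t ht a).fun_mul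
      (HasDerivWithinAt.fun_sum fun c (_ : c ∈ Finset.univ) => (hXd t ht c).const_mul (D.P a c))
    have h2 : X' t ⬝ᵥ D.P *ᵥ X t = X t ⬝ᵥ D.P *ᵥ X' t := dotProduct_mulVec_comm hD.posDef_P _ _
    refine h1.congr_deriv ?_
    rw [Finset.sum_add_distrib, two_mul]
    exact congrArg (· + X t ⬝ᵥ D.P *ᵥ X' t) h2
  have hUc : ContinuousOn U (Ico t0 t1) := by
    simp only [hU, dotProduct, Matrix.mulVec]
    fun_prop
  have hr0 : (0 : ℝ) < (r : ℝ) + 1 := by positivity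
  have hbd := le_max_of_deriv_right_le (V := U) (κ := D.v1 / (4 * ((r : ℝ) + 1)))
    (g := fun t => D.alphaX (mu t0 T t))
    (M := (D.v1 / (4 * ((r : ℝ) + 1)))⁻¹ * (lamMax D.P * (r * (|D.K 0| * L) ^ 2)))
    (by positivity) hUc hUd (fun t ht => hα.pos (mu_pos (hlt t ht))) fun t ht =>
      chain_dissipation hn hD.posDef_P hD.posDef_Q hD.lyapunov (hα.pos (mu_pos (hlt t ht)))
        (hα.logRate_nonneg (mu_pos (hlt t ht)))
        (hα.logRate_le (mu_pos (hlt t ht)) (hD.dc1_deriv _ (mu_pos (hlt t ht))))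
        (fun a => rfl) (hYg t ht)
  set R := max (U t0) ((D.v1 / (4 * ((r : ℝ) + 1)))⁻¹ * (lamMax D.P * (r * (|D.K 0| * L) ^ 2)) /
    (D.v1 / (4 * ((r : ℝ) + 1))) + 1)
  have hlow := lamMin_pos hD.posDef_P
  have hξb : ∀ t ∈ Ico t0 t1, ∀ j : Fin r, ‖ξ t j.castSucc‖ ≤ Real.sqrt (R / lamMin D.P) := by
    intro t ht j
    refine Real.le_sqrt_of_sq_le ?_
    rw [le_div_iff₀ hlow, mul_comm]
    refine le_trans (mul_le_mul_of_nonneg_left ?_ hlow.le)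
      ((lamMin_mul_le hD.posDef_P (X t)).trans (hbd t ht))
    rw [EuclideanSpace.real_norm_sq_eq, dotProduct, Fintype.sum_prod_type]
    have h1 : ∀ i : Fin r, 0 ≤ ∑ k, X t (i, k) * X t (i, k) := fun i =>
      Finset.sum_nonneg fun k _ => mul_self_nonneg _
    refine le_trans (le_of_eq ?_) (Finset.single_le_sum (fun i _ => h1 i) (Finset.mem_univ j))
    exact Finset.sum_congr rfl fun k _ => sq _
  -- The last error is not part of `X`; it is recovered algebraically from `hrel`.
  have hlast : ∀ t ∈ Ico t0 t1, ‖ξ t (Fin.last r)‖ ≤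
      |D.K 0| * L + ∑ j, |D.K j| * Real.sqrt (R / lamMin D.P) := by
    intro t ht
    have h1 : ξ t (Fin.last r) = g t - ∑ j : Fin r, D.K j • ξ t j.castSucc := by
      rw [← hrel t ht]; abel
    rw [h1]
    refine (norm_sub_le _ _).trans (add_le_add (hgL t ht) ((norm_sum_le _ _).trans ?_))
    refine Finset.sum_le_sum fun j _ => ?_
    rw [norm_smul, Real.norm_eq_abs]
    exact mul_le_mul_of_nonneg_left (hξb t ht j) (abs_nonneg _)
  refine ⟨max (Real.sqrt (R / lamMin D.P))
    (|D.K 0| * L + ∑ j, |D.K j| * Real.sqrt (R / lamMin D.P)), fun t ht q => ?_⟩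
  refine Fin.lastCases ?_ (fun j => ?_) q
  · exact (hlast t ht).trans (le_max_right _ _)
  · exact (hξb t ht j).trans (le_max_left _ _)

end Design

/-! ### Bounds on state, input and output of one agent. -/

namespace Design

variable {r n : ℕ} {D : Design r n} {alpha : ℝ → ℝ} {cst : ℝ}

theorem norm_sub_le_of_scaledError {s b₀ C : ℝ} (hb₀ : 0 < b₀) (hb : b₀ ≤ D.alphaX s) {z : E n}
    {x : Fin (r + 1) → E n} {q : Fin (r + 1)} (h : ‖D.scaledError s z x q‖ ≤ C) :
    ‖x q - if q = 0 then z else 0‖ ≤ (1 + b₀⁻¹) ^ (r + 1) * C := by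
  have hs : 0 < D.alphaX s := hb₀.trans_le hb
  have hp := pow_pos hs (r + 1 - (q : ℕ))
  have h1 : x q - (if q = 0 then z else 0)
      = (D.alphaX s ^ (r + 1 - (q : ℕ)))⁻¹ • D.scaledError s z x q := by
    rw [scaledError, inv_smul_smul₀ hp.ne']
  rw [h1, norm_smul, norm_inv, Real.norm_of_nonneg hp.le]
  refine mul_le_mul ?_ h (norm_nonneg _) (by positivity)
  -- The added `1` makes the base at least one, so a single power bounds the weights of all `q`.
  have h2 : (D.alphaX s)⁻¹ ≤ 1 + b₀⁻¹ := by
    have := inv_anti₀ hb₀ hb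
    linarith
  rw [← inv_pow]
  calc (D.alphaX s)⁻¹ ^ (r + 1 - (q : ℕ)) ≤ (1 + b₀⁻¹) ^ (r + 1 - (q : ℕ)) := by gcongr
    _ ≤ (1 + b₀⁻¹) ^ (r + 1) :=
      pow_le_pow_right₀ (by linarith [inv_pos.2 hb₀]) (Nat.sub_le _ _)

theorem norm_piTerm_le [NeZero r] {s κ C : ℝ} (hs : 0 < D.alphaX s) (hδ : 0 ≤ D.deltaX s)
    (hδκ : D.deltaX s ≤ κ * D.alphaX s) {z : E n} {x : Fin (r + 1) → E n}
    (h : ∀ q, ‖D.scaledError s z x q‖ ≤ C) :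
    ‖D.piTerm s x‖ ≤ ∑ j, |D.K j| * (C + r * κ * C) + r * κ * C := by
  have hC : 0 ≤ C := (norm_nonneg _).trans (h 0)
  have h0 : 0 ≤ D.deltaX s / D.alphaX s := div_nonneg hδ hs.le
  have h1 : D.deltaX s / D.alphaX s ≤ κ := by rwa [div_le_iff₀ hs]
  have h2 : ∀ (k : ℕ) (q : Fin (r + 1)), k ≤ r →
      ‖((k : ℝ) * (D.deltaX s / D.alphaX s)) • D.scaledError s z x q‖ ≤ r * κ * C := by
    intro k q hk
    rw [norm_smul, Real.norm_of_nonneg (by positivity)]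
    have : (k : ℝ) ≤ r := Nat.cast_le.2 hk
    exact mul_le_mul (by gcongr) (h q) (norm_nonneg _)
      (mul_nonneg (Nat.cast_nonneg _) (h0.trans h1))
  rw [piTerm_eq hs.ne' z]
  refine (norm_sub_le _ _).trans (add_le_add ((norm_sum_le _ _).trans ?_) (h2 r _ le_rfl))
  refine Finset.sum_le_sum fun j _ => ?_
  rw [norm_smul, Real.norm_eq_abs]
  refine mul_le_mul_of_nonneg_left ((norm_sub_le _ _).trans ?_) (abs_nonneg _)
  exact add_le_add (h _) (h2 j _ j.2.le)

/-- Boundedness of the state and the input of one agent, and the rate at which its output follows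
`z`, when its reference approaches `z` sufficiently fast. -/
theorem exists_agent_bound [NeZero r] (hn : 1 ≤ n) (hD : D.Admissible alpha cst)
    {t0 T t1 : ℝ} (hT : 0 < T) (ht1 : t1 ≤ t0 + T)
    {x : ℝ → Fin (r + 1) → E n} {w w' y : ℝ → E n} {z : E n}
    (hwc : ContinuousOn w (Ico t0 t1)) (hxc : ContinuousOn x (Ico t0 t1))
    (hw : ∀ t ∈ Ico t0 t1, HasDerivWithinAt w (w' t) (Ici t) t)
    (hx : ∀ t ∈ Ico t0 t1, ∀ q : Fin r,
      HasDerivWithinAt (fun s => x s q.castSucc) (x t q.succ) (Ici t) t)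
    (hxl : ∀ t ∈ Ico t0 t1, HasDerivWithinAt (fun s => x s (Fin.last r))
      (D.control (mu t0 T t) (x t) (w t) + y t) (Ici t) t)
    {H M L : ℝ} (hy : ∀ t ∈ Ico t0 t1, ‖y t‖ ≤ H * D.psi (x t))
    (hM : ∀ t ∈ Ico t0 t1, D.alphaX (mu t0 T t) ^ r * ‖w' t‖ ≤ M)
    (hL : ∀ t ∈ Ico t0 t1, D.alphaX (mu t0 T t) ^ (r + 1) * ‖w t - z‖ ≤ L) :
    ∃ C, ∀ t ∈ Ico t0 t1, (∀ q, ‖x t q‖ ≤ C) ∧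
      ‖D.control (mu t0 T t) (x t) (w t)‖ ≤ C ∧
      D.alphaX (mu t0 T t) ^ (r + 1) * ‖x t 0 - z‖ ≤ C := by
  have hα := hD.alphaX_class
  have hd := hD.alphaX_diff
  have hK : D.K 0 ≠ 0 := K_zero_ne_zero hD.hurwitz
  have hlt : ∀ t ∈ Ico t0 t1, t < t0 + T := fun t ht => ht.2.trans_le ht1
  have hv1 := v1_pos hn hD.posDef_P hD.posDef_Q
  obtain ⟨Ce, hCe⟩ := exists_norm_eTilde_le hK hα hd hD.s0_pos hD.v_pos ht1 hwc hxc hw hx hxl hy hM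
  have hT' : 0 < 1 / T := one_div_pos.2 hT
  -- The point `1 / T = μ(t₀)` is the least value that `μ` takes.
  obtain ⟨c, hc, hcs⟩ := exists_mul_pow_le_alphaS hα hD.s0_pos hv1.le hT'
  have hsT : ∀ t ∈ Ico t0 t1, D.alphaX (mu t0 T t) ^ (r + 1) *
      ‖D.sTilde (mu t0 T t) (x t) (w t)‖ ≤ c⁻¹ * Ce := by
    intro t ht
    rw [inv_mul_eq_div, le_div_iff₀ hc]
    refine le_trans ?_ (hCe t ht)
    rw [eTilde, norm_smul, Real.norm_of_nonneg (alphaS_pos hα (mu_pos (hlt t ht))).le]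
    have := mul_le_mul_of_nonneg_right (hcs _ (le_mu ht.1 (hlt t ht)))
      (norm_nonneg (D.sTilde (mu t0 T t) (x t) (w t)))
    linarith
  obtain ⟨Cξ, hCξ⟩ := exists_norm_scaledError_le (w := w) (z := z) (L := c⁻¹ * Ce + L) hn hD ht1
    hxc hx fun t ht => by
      have hb := pow_pos (hα.pos (mu_pos (hlt t ht))) (r + 1)
      refine (mul_le_mul_of_nonneg_left (norm_add_le _ _) hb.le).trans ?_
      rw [mul_add]
      exact add_le_add (hsT t ht) (hL t ht)
  obtain ⟨Ψ, hΨ⟩ := hD.psi_bdd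
  have hb₀ := hα.pos hT'
  set κ := D.v1 / (2 * D.v2) with hκ
  set C1 := ‖z‖ + (1 + (D.alphaX (1 / T))⁻¹) ^ (r + 1) * Cξ
  set C2 := (D.v + Ψ ^ 2 + 1) * Ce + (∑ j, |D.K j| * (Cξ + r * κ * Cξ) + r * κ * Cξ)
    + |D.K 0| * (((r : ℝ) + 1) * κ + D.v1 / 2) * (c⁻¹ * Ce)
  refine ⟨max C1 (max C2 Cξ), fun t ht => ⟨fun q => ?_, ?_, ?_⟩⟩
  · refine le_trans ?_ (le_max_left _ _)
    have hbb : D.alphaX (1 / T) ≤ D.alphaX (mu t0 T t) :=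
      hα.strictMonoOn.monotoneOn hT'.le (mu_pos (hlt t ht)).le (le_mu ht.1 (hlt t ht))
    have h1 := norm_sub_le_of_scaledError hb₀ hbb (hCξ t ht q)
    have h2 : ‖(if q = 0 then z else 0 : E n)‖ ≤ ‖z‖ := by
      split_ifs
      · exact le_rfl
      · rw [norm_zero]; exact norm_nonneg _
    have h3 := norm_le_norm_add_norm_sub' (x t q) (if q = 0 then z else 0 : E n)
    linarith
  · refine le_trans ?_ ((le_max_left _ _).trans (le_max_right _ _))
    have hs := mu_pos (hlt t ht)
    have hb := hα.pos hs
    have hδ0 : 0 ≤ D.deltaX (mu t0 T t) := hα.logRate_nonneg hs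
    have hδ : D.deltaX (mu t0 T t) ≤ κ * D.alphaX (mu t0 T t) :=
      hα.logRate_le hs (hD.dc1_deriv _ hs)
    have hsign : |Real.sign (D.K 0)| ≤ 1 := by
      rcases Real.sign_apply_eq (D.K 0) with h | h | h <;> rw [h] <;> simp
    have h1 : ‖((D.v + D.psi (x t) ^ 2 + 1) * Real.sign (D.K 0)) •
        D.eTilde (mu t0 T t) (x t) (w t)‖ ≤ (D.v + Ψ ^ 2 + 1) * Ce := by
      have hp := hD.psi_pos (x t)
      have hv := hD.v_pos
      rw [norm_smul, Real.norm_eq_abs, abs_mul, abs_of_pos (by positivity)]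
      refine mul_le_mul ?_ (hCe t ht) (norm_nonneg _) (by positivity)
      refine (mul_le_of_le_one_right (by positivity) hsign).trans ?_
      have := hΨ (x t)
      gcongr
    have h2 := norm_piTerm_le (z := z) hb hδ0 hδ (hCξ t ht)
    have h3 : ‖((D.B (mu t0 T t))⁻¹ * D.deltaS (mu t0 T t)) •
        D.sTilde (mu t0 T t) (x t) (w t)‖
        ≤ |D.K 0| * (((r : ℝ) + 1) * κ + D.v1 / 2) * (c⁻¹ * Ce) := by
      have h4 : D.deltaS (mu t0 T t) ≤
          (((r : ℝ) + 1) * κ + D.v1 / 2) * D.alphaX (mu t0 T t) := by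
        rw [deltaS_eq hα hd hD.s0_pos hs]
        have := mul_le_mul_of_nonneg_left hδ (by positivity : (0 : ℝ) ≤ (r : ℝ) + 1)
        linarith
      have h5 : 0 ≤ D.deltaS (mu t0 T t) := by
        rw [deltaS_eq hα hd hD.s0_pos hs]; positivity
      have hk : 0 ≤ ((r : ℝ) + 1) * κ + D.v1 / 2 := by
        have : 0 ≤ κ := by
          rcases le_or_gt 0 κ with h | h
          · exact h
          · exact absurd (hδ0.trans hδ) (not_le.2 (mul_neg_of_neg_of_pos h hb))
        positivity
      rw [norm_smul, B, mul_inv, inv_inv, inv_inv, Real.norm_eq_abs, abs_mul, abs_mul,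
        abs_of_pos (pow_pos hb r), abs_of_nonneg h5]
      calc |D.K 0| * D.alphaX (mu t0 T t) ^ r * D.deltaS (mu t0 T t) *
            ‖D.sTilde (mu t0 T t) (x t) (w t)‖
          ≤ |D.K 0| * D.alphaX (mu t0 T t) ^ r *
            ((((r : ℝ) + 1) * κ + D.v1 / 2) * D.alphaX (mu t0 T t)) *
            ‖D.sTilde (mu t0 T t) (x t) (w t)‖ := by gcongr
        _ = |D.K 0| * (((r : ℝ) + 1) * κ + D.v1 / 2) * (D.alphaX (mu t0 T t) ^ (r + 1) *
            ‖D.sTilde (mu t0 T t) (x t) (w t)‖) := by ring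
        _ ≤ _ := mul_le_mul_of_nonneg_left (hsT t ht) (mul_nonneg (abs_nonneg _) hk)
    rw [control]
    refine (norm_sub_le _ _).trans (add_le_add ((norm_sub_le _ _).trans (add_le_add ?_ h2)) h3)
    rw [norm_neg]
    exact h1
  · refine le_trans ?_ ((le_max_right _ _).trans (le_max_right _ _))
    have h1 := hCξ t ht 0
    rwa [scaledError, if_pos rfl, Fin.val_zero, Nat.sub_zero, norm_smul,
      Real.norm_of_nonneg (pow_pos (hα.pos (mu_pos (hlt t ht))) _).le] at h1

end Design

/-! ### The generator along trajectories. -/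

/-- The gradients of the local costs add up to zero at a global minimizer. -/
theorem sum_gradient_eq_zero {N n : ℕ} {f : Fin N → E n → ℝ} (hf : ∀ i, Differentiable ℝ (f i))
    {z : E n} (hz : ∀ z', ∑ i, f i z ≤ ∑ i, f i z') : ∑ i, gradient (f i) z = 0 := by
  have h1 : HasFDerivAt (fun z => ∑ i, f i z) (∑ i, fderiv ℝ (f i) z) z :=
    HasFDerivAt.fun_sum fun i _ => (hf i z).hasFDerivAt
  have h2 : IsLocalMin (fun z => ∑ i, f i z) z := Eventually.of_forall hz
  have h3 := h2.hasFDerivAt_eq_zero h1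
  simp only [gradient, ← map_sum, h3, map_zero]

/-- Exponential decay of the generator in the time scale of its gain: there is an energy `V`
with `V' ≤ -2 c^* α(μ) V` whose square root bounds all errors of the generator. -/
theorem exists_generator_energy {N r n nd : ℕ} [NeZero r] (hN : 2 ≤ N)
    {G : WeightedGraph N} (hG : G.graph.Connected)
    {f : Fin N → E n → ℝ} (hf : ∀ i, Differentiable ℝ (f i))
    {rho rhoL : ℝ} (hrho : 0 < rho) (hrhoL : 0 < rhoL)
    (hconv : ∀ i z z', rho * ‖z - z'‖ ^ 2 ≤
      inner ℝ (gradient (f i) z - gradient (f i) z') (z - z'))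
    (hlip : ∀ i z z', ‖gradient (f i) z - gradient (f i) z'‖ ≤ rhoL * ‖z - z'‖)
    {zstar : E n} (hz : ∀ z, ∑ i, f i zstar ≤ ∑ i, f i z)
    {alpha : ℝ → ℝ} (halpha : ClassKInf alpha) {D : Fin N → Design r n}
    {phi : Fin N → (Fin (r + 1) → E n) → E nd → E n} {d : Fin N → ℝ → E nd} {t0 T t1 : ℝ}
    (ht1T : t1 ≤ t0 + T) {w p : Fin N → ℝ → E n} {x : Fin N → ℝ → Fin (r + 1) → E n}
    (htraj : IsTrajectory G f alpha D phi d t0 T t1 w p x) (hp0 : ∑ i, p i t0 = 0) :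
    ∃ V V' : ℝ → ℝ, ContinuousOn V (Ico t0 t1) ∧
      (∀ t ∈ Ico t0 t1, HasDerivWithinAt V (V' t) (Ici t) t) ∧
      (∀ t ∈ Ico t0 t1, 0 ≤ V t) ∧
      (∀ t ∈ Ico t0 t1,
        V' t ≤ -(2 * cStar (G.lambda2 hN) rho rhoL * alpha (mu t0 T t)) * V t) ∧
      ∃ C, 0 ≤ C ∧ ∀ t ∈ Ico t0 t1, ∀ i, ‖w i t - zstar‖ ≤ C * √(V t) ∧
        ‖p i t + gradient (f i) zstar‖ ≤ C * √(V t) ∧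
        ‖∑ j, G.weight i j • (w i t - w j t) + gradient (f i) (w i t) + p i t‖ ≤ C * √(V t) := by
  obtain ⟨hlam, v, l, i₀, hv, heig, hl₀, hv₀, hl⟩ := G.exists_spectral_decomposition hN hG
  set c := c1 (G.lambda2 hN) rho rhoL
  have hc : 0 < c := c1_pos hlam
  have hl' : ∀ i, 0 ≤ l i := fun i => by
    by_cases hi : i = i₀
    · rw [hi, hl₀]
    · exact hlam.le.trans (hl i hi)
  set e : ℝ → Fin N → E n := fun t i => w i t - zstar with he
  set q : ℝ → Fin N → E n := fun t i => p i t + gradient (f i) zstar with hq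
  set q' : ℝ → Fin N → E n := fun t i => ∑ j, G.weight i j • (e t i - e t j) with hq'
  set g : ℝ → Fin N → E n := fun t i => gradient (f i) (w i t) - gradient (f i) zstar with hg
  set e' : ℝ → Fin N → E n := fun t i => -(q' t i + g t i + q t i) with he'
  have hq'w : ∀ t i, ∑ j, G.weight i j • (w i t - w j t) = q' t i := by
    intro t i
    simp only [hq', he, sub_sub_sub_cancel_right]
  have hsum' : ∀ t i, ∑ j, G.weight i j • (w i t - w j t) + gradient (f i) (w i t) + p i t
      = q' t i + g t i + q t i := by
    intro t i
    rw [hq'w]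
    simp only [hg, hq]
    abel
  have hed : ∀ t ∈ Ico t0 t1, ∀ i, HasDerivWithinAt (fun t => e t i)
      (alpha (mu t0 T t) • e' t i) (Ici t) t := by
    intro t ht i
    refine ((htraj.deriv_w i t ht).sub_const zstar).congr_deriv ?_
    rw [hsum', he', smul_neg]
  have hqd : ∀ t ∈ Ico t0 t1, ∀ i, HasDerivWithinAt (fun t => q t i)
      (alpha (mu t0 T t) • q' t i) (Ici t) t := by
    intro t ht i
    refine ((htraj.deriv_p i t ht).add_const (gradient (f i) zstar)).congr_deriv ?_
    rw [hq'w]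
  have hec : ∀ i, ContinuousOn (fun t => e t i) (Ico t0 t1) := fun i =>
    (htraj.continuousOn_w i).fun_sub continuousOn_const
  have hqc : ∀ i, ContinuousOn (fun t => q t i) (Ico t0 t1) := fun i =>
    (htraj.continuousOn_p i).fun_add continuousOn_const
  -- The sum is conserved by symmetry of the weights, and vanishes at `t0` by the initialization of
  -- `p` and optimality of `zstar`.
  have hq0 : ∀ t ∈ Ico t0 t1, ∑ i, q t i = 0 := by
    intro t ht
    have hsub : Icc t0 t ⊆ Ico t0 t1 := fun s hs => ⟨hs.1, hs.2.trans_lt ht.2⟩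
    have h1 := constant_of_has_deriv_right_zero (f := fun t => ∑ i, q t i) (a := t0) (b := t)
      (continuousOn_finsetSum _ fun i _ => (hqc i).mono hsub) (fun s hs => by
        refine (HasDerivWithinAt.fun_sum fun i (_ : i ∈ Finset.univ) =>
          hqd s (hsub ⟨hs.1, hs.2.le⟩) i).congr_deriv ?_
        rw [← Finset.smul_sum, hq', G.sum_weight_smul_sub_eq_zero, smul_zero]) t
      (right_mem_Icc.2 ht.1)
    rw [h1]
    simp only [hq, Finset.sum_add_distrib, hp0, sum_gradient_eq_zero hf hz, add_zero]
  set C₀ := √c⁻¹ + 1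
  have hC₀ : 0 ≤ C₀ := by positivity
  -- The total weight bounds every row sum, so in units of `C₀ √V` the Laplacian, gradient and `q`
  -- terms cost `2 * W`, `rhoL` and `1`.
  set W := ∑ i, ∑ j, G.weight i j with hW
  have hWi : ∀ i, ∑ j, G.weight i j ≤ W := fun i =>
    Finset.single_le_sum (f := fun i => ∑ j, G.weight i j)
      (fun i _ => Finset.sum_nonneg fun j _ => G.nonneg i j) (Finset.mem_univ i)
  have hW0 : 0 ≤ W := Finset.sum_nonneg fun i _ => Finset.sum_nonneg fun j _ => G.nonneg i j
  have hbound := fun t i => norm_le_sqrt_genEnergy (v := v) hc hl' (e t) (q t) i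
  refine ⟨fun t => genEnergy c v l (e t) (q t), _, continuousOn_genEnergy hec hqc,
    fun t ht => hasDerivWithinAt_genEnergy (hed t ht) (hqd t ht), fun t ht => ?_, fun t ht => ?_,
    (2 * W + rhoL + 1) * C₀, by positivity, fun t ht i => ?_⟩
  · have := le_genEnergy (v := v) hc.le hl' (e t) (q t) i₀
    exact le_trans (by positivity) this
  · have ha := halpha.pos (mu_pos (t0 := t0) (T := T) (ht.2.trans_le ht1T))
    have h1 := genEnergy_dissipation hlam hrho hv heig hl₀ hv₀ hl (e t) (q t) (g t) (hq0 t ht)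
      (fun i => hconv i (w i t) zstar) (fun i => hlip i (w i t) zstar) (q' := q' t) (e' := e' t)
      (fun i => rfl) (fun i => rfl)
    have h2 := mul_le_mul_of_nonneg_left h1 ha.le
    refine (le_of_eq ?_).trans (h2.trans (le_of_eq ?_))
    · simp only [← smul_add, real_inner_smul_right, smul_comm _ (alpha (mu t0 T t)),
        ← Finset.smul_sum, mul_left_comm _ (alpha (mu t0 T t)), ← Finset.mul_sum]
      ring
    · ring
  · obtain ⟨h1, h2⟩ := hbound t i
    set S := √(genEnergy c v l (e t) (q t))
    have hS : 0 ≤ S := Real.sqrt_nonneg _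
    have hCS : 0 ≤ C₀ * S := mul_nonneg hC₀ hS
    have h0 : C₀ * S ≤ (2 * W + rhoL + 1) * C₀ * S := by
      rw [mul_assoc]
      exact le_mul_of_one_le_left hCS (by linarith)
    refine ⟨h1.trans h0, h2.trans h0, ?_⟩
    rw [hsum']
    have h3 : ‖q' t i‖ ≤ 2 * W * (C₀ * S) := by
      calc ‖q' t i‖ ≤ ∑ j, G.weight i j * (2 * (C₀ * S)) := by
            refine (norm_sum_le _ _).trans (Finset.sum_le_sum fun j _ => ?_)
            rw [norm_smul, Real.norm_of_nonneg (G.nonneg i j)]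
            refine mul_le_mul_of_nonneg_left ((norm_sub_le _ _).trans ?_) (G.nonneg i j)
            linarith [(hbound t j).1]
        _ ≤ W * (2 * (C₀ * S)) := by
            rw [← Finset.sum_mul]
            exact mul_le_mul_of_nonneg_right (hWi i) (by positivity)
        _ = _ := by ring
    have h4 : ‖g t i‖ ≤ rhoL * (C₀ * S) :=
      (hlip i (w i t) zstar).trans (mul_le_mul_of_nonneg_left h1 hrhoL.le)
    have h5 := norm_add₃_le (a := q' t i) (b := g t i) (c := q t i)
    linarith

/-- `α_x(μ)^m ‖ϖ - z‖` and `α_x(μ)^{m-1} α(μ) ‖·‖` stay bounded for quantities dominated by the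
square root of an energy decaying at the rate `2 c^* α(μ)`. -/
theorem Design.weighted_energy_le {r n : ℕ} [NeZero r] (hn : 1 ≤ n) {D : Design r n}
    {alpha : ℝ → ℝ} {cst : ℝ} (hcst : 0 < cst) (hD : D.Admissible alpha cst)
    (halpha : ClassKInf alpha) (halpha_diff : ∀ s, 0 < s → DifferentiableAt ℝ alpha s)
    (halpha_deriv : ∀ s, 0 < s → deriv alpha s ≤ 1 / 2 * cst * (s ^ 2)⁻¹ * alpha s ^ 2)
    {t0 T t1 : ℝ} (ht1T : t1 ≤ t0 + T) {V V' : ℝ → ℝ} (hVc : ContinuousOn V (Ico t0 t1))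
    (hVd : ∀ t ∈ Ico t0 t1, HasDerivWithinAt V (V' t) (Ici t) t)
    (hV0 : ∀ t ∈ Ico t0 t1, 0 ≤ V t)
    (hV' : ∀ t ∈ Ico t0 t1, V' t ≤ -(2 * cst * alpha (mu t0 T t)) * V t) :
    (∃ L, ∀ t ∈ Ico t0 t1, D.alphaX (mu t0 T t) ^ (r + 1) * √(V t) ≤ L) ∧
      ∃ L, ∀ t ∈ Ico t0 t1, alpha (mu t0 T t) * D.alphaX (mu t0 T t) ^ r * √(V t) ≤ L := by
  have hα := hD.alphaX_class
  have hlt : ∀ t ∈ Ico t0 t1, t < t0 + T := fun t ht => ht.2.trans_le ht1T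
  have hv1 := v1_pos hn hD.posDef_P hD.posDef_Q
  have hv2 := le_v2 (D := D) hn hD.posDef_P
  have hr : (0 : ℝ) ≤ r := Nat.cast_nonneg r
  have ha : ∀ t ∈ Ico t0 t1, 0 < alpha (mu t0 T t) := fun t ht => halpha.pos (mu_pos (hlt t ht))
  have hb : ∀ t ∈ Ico t0 t1, 0 < D.alphaX (mu t0 T t) := fun t ht => hα.pos (mu_pos (hlt t ht))
  -- Both parts of the condition on `α_x` combine, `v₁` cancels, and `v₂ ≥ 2m` gives the factor
  -- `4m`.
  have hrate : ∀ t ∈ Ico t0 t1, 4 * ((r : ℝ) + 1) * logRate D.alphaX (mu t0 T t)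
      ≤ cst * alpha (mu t0 T t) := by
    intro t ht
    have hs := mu_pos (hlt t ht)
    have h1 := hα.logRate_le hs (hD.dc1_deriv _ hs)
    have h2 := hD.dc1_le _ hs
    rw [div_mul_eq_mul_div, le_div_iff₀ hv1] at h2
    have h3 := hα.logRate_nonneg hs
    have hv2' : 0 < D.v2 := by linarith
    rw [div_mul_eq_mul_div, le_div_iff₀ (by positivity)] at h1
    nlinarith [mul_le_mul_of_nonneg_right hv2 h3]
  have hrate' : ∀ t ∈ Ico t0 t1, logRate alpha (mu t0 T t) ≤ 1 / 2 * cst * alpha (mu t0 T t) :=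
    fun t ht => halpha.logRate_le (mu_pos (hlt t ht)) (halpha_deriv _ (mu_pos (hlt t ht)))
  have hsqrt : ∀ {F A B : ℝ}, 0 ≤ F → F ^ 2 * A ≤ B → F * √A ≤ √B := by
    intro F A B hF h
    rw [← Real.sqrt_sq hF, ← Real.sqrt_mul (sq_nonneg _)]
    exact Real.sqrt_le_sqrt h
  have hcont : ∀ {β : ℝ → ℝ}, ClassKInf β → (∀ s, 0 < s → DifferentiableAt ℝ β s) → ∀ k : ℕ,
      ContinuousOn (fun t => β (mu t0 T t) ^ k) (Ico t0 t1) := fun hβ hβd k t ht =>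
    (hβ.hasDerivAt_comp_mu_pow hβd (hlt t ht) k).continuousAt.continuousWithinAt
  constructor
  · have h := mul_le_of_deriv_right_le (F := fun t => D.alphaX (mu t0 T t) ^ (2 * (r + 1)))
      (hcont hα hD.alphaX_diff _) hVc
      (fun t ht => (hα.hasDerivAt_comp_mu_pow hD.alphaX_diff (hlt t ht) _).hasDerivWithinAt) hVd
      (fun t ht => (pow_pos (hb t ht) _).le) hV0 hV' (fun t ht => by
        have h1 := hrate t ht
        have h2 := mul_pos hcst (ha t ht)
        push_cast
        linarith)
    exact ⟨_, fun t ht => hsqrt (pow_pos (hb t ht) _).le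
      ((le_of_eq (by rw [← pow_mul, mul_comm (r + 1)])).trans (h t ht))⟩
  -- The squared weight grows at rate at most `c* α + c* α / 2`, the two parts coming from `α²` and
  -- `α_x^(2r)`; this is below the decay rate `2 c* α`.
  · have h := mul_le_of_deriv_right_le
      (F := fun t => alpha (mu t0 T t) ^ 2 * D.alphaX (mu t0 T t) ^ (2 * r))
      (φ := fun t => 2 * logRate alpha (mu t0 T t) + 2 * r * logRate D.alphaX (mu t0 T t))
      ((hcont halpha halpha_diff _).mul (hcont hα hD.alphaX_diff _)) hVc
      (fun t ht => by
        refine ((halpha.hasDerivAt_comp_mu_pow halpha_diff (hlt t ht) 2).fun_mul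
          (hα.hasDerivAt_comp_mu_pow hD.alphaX_diff (hlt t ht) (2 * r))).hasDerivWithinAt.congr_deriv
            ?_
        push_cast
        ring) hVd
      (fun t ht => (mul_pos (pow_pos (ha t ht) _) (pow_pos (hb t ht) _)).le) hV0 hV' (fun t ht => by
        have h1 := hrate t ht
        have h2 := hrate' t ht
        have h3 := mul_pos hcst (ha t ht)
        have h4 := hα.logRate_nonneg (mu_pos (hlt t ht))
        nlinarith)
    exact ⟨_, fun t ht => hsqrt (mul_pos (ha t ht) (pow_pos (hb t ht) _)).le
      ((le_of_eq (by rw [mul_pow, ← pow_mul, mul_comm r])).trans (h t ht))⟩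

end DPTCO

/-! ### Assembly of the cascade. -/

theorem theorem4 {N r n nd : ℕ} [NeZero r] (hN : 2 ≤ N) (hn : 1 ≤ n)
    -- communication graph
    (G : DPTCO.WeightedGraph N) (hG : G.graph.Connected)
    -- local cost functions and the global optimum
    (f : Fin N → DPTCO.E n → ℝ) (hf : ∀ i, Differentiable ℝ (f i))
    (rho rhoL : ℝ) (hrho : 0 < rho) (hrhoL : 0 < rhoL)
    (hconv : ∀ i z z', rho * ‖z - z'‖ ^ 2 ≤
      inner ℝ (gradient (f i) z - gradient (f i) z') (z - z'))
    (hlip : ∀ i z z', ‖gradient (f i) z - gradient (f i) z'‖ ≤ rhoL * ‖z - z'‖)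
    (zstar : DPTCO.E n) (hz : ∀ z, ∑ i, f i zstar ≤ ∑ i, f i z)
    -- gain of the generator
    (alpha : ℝ → ℝ) (halpha : DPTCO.ClassKInf alpha)
    (halpha_diff : ∀ s, 0 < s → DifferentiableAt ℝ alpha s)
    (halpha_deriv : ∀ s, 0 < s → deriv alpha s ≤
      1 / 2 * DPTCO.cStar (G.lambda2 hN) rho rhoL * (s ^ 2)⁻¹ * alpha s ^ 2)
    -- local controllers
    (D : Fin N → DPTCO.Design r n)
    (hD : ∀ i, (D i).Admissible alpha (DPTCO.cStar (G.lambda2 hN) rho rhoL))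
    -- uncertainties
    (S : Set (DPTCO.E nd)) (hS : IsCompact S)
    (phi : Fin N → (Fin (r + 1) → DPTCO.E n) → DPTCO.E nd → DPTCO.E n)
    (hphi : ∀ i, ∃ h : ℝ → ℝ, (∀ s, 0 ≤ s → 0 ≤ h s) ∧ MonotoneOn h (Ici 0) ∧
      ∀ x, ∀ δ ∈ S, ‖phi i x δ‖ ≤ h ‖δ‖ * (D i).psi x)
    -- initial time, prescribed time and disturbances
    (t0 T : ℝ) (hT : 0 < T)
    (d : Fin N → ℝ → DPTCO.E nd) (hd : ∀ i, ∀ t ∈ Ico t0 (t0 + T), d i t ∈ S)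
    -- a trajectory of the closed loop on `[t0, t1)`
    (t1 : ℝ) (ht1 : t0 < t1) (ht1T : t1 ≤ t0 + T)
    (w p : Fin N → ℝ → DPTCO.E n) (x : Fin N → ℝ → Fin (r + 1) → DPTCO.E n)
    (htraj : DPTCO.IsTrajectory G f alpha D phi d t0 T t1 w p x)
    (hp0 : ∑ i, p i t0 = 0) :
    -- all states and inputs are bounded (in particular there is no escape before `t0 + T`)
    (∃ C : ℝ, ∀ t ∈ Ico t0 t1, ∀ i, ‖w i t‖ ≤ C ∧ ‖p i t‖ ≤ C ∧ (∀ q, ‖x i t q‖ ≤ C) ∧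
      ‖(D i).control (DPTCO.mu t0 T t) (x i t) (w i t)‖ ≤ C) ∧
    -- the outputs `y i = x i 0` reach the optimum at the prescribed time
    (t1 = t0 + T → ∀ i, Tendsto (fun t => ‖x i t 0 - zstar‖) (𝓝[<] (t0 + T)) (𝓝 0)) := by
  have hlam := (G.exists_spectral_decomposition hN hG).1
  have hcst := DPTCO.cStar_pos (rho := rho) (rhoL := rhoL) hlam
  have hlt : ∀ t ∈ Ico t0 t1, t < t0 + T := fun t ht => ht.2.trans_le ht1T
  obtain ⟨V, V', hVc, hVd, hV0, hV', C, hC, hbound⟩ := DPTCO.exists_generator_energy hN hG hf hrho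
    hrhoL hconv hlip hz halpha ht1T htraj hp0
  have hVle : ∀ t ∈ Ico t0 t1, V t ≤ V t0 := DPTCO.le_of_deriv_right_nonpos hVc hVd fun t ht => by
    have h1 := mul_nonneg (mul_pos hcst (halpha.pos (DPTCO.mu_pos (hlt t ht)))).le (hV0 t ht)
    linarith [hV' t ht]
  have hagent : ∀ i, ∃ C, ∀ t ∈ Ico t0 t1, (∀ q, ‖x i t q‖ ≤ C) ∧
      ‖(D i).control (DPTCO.mu t0 T t) (x i t) (w i t)‖ ≤ C ∧
      (D i).alphaX (DPTCO.mu t0 T t) ^ (r + 1) * ‖x i t 0 - zstar‖ ≤ C := by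
    intro i
    obtain ⟨⟨L₁, hL₁⟩, L₂, hL₂⟩ := DPTCO.Design.weighted_energy_le hn hcst (hD i) halpha halpha_diff
      halpha_deriv ht1T hVc hVd hV0 hV'
    obtain ⟨h, -, hmono, hφ⟩ := hphi i
    -- Compactness serves only to replace the unknown `h ‖d‖` by the constant `h R`.
    obtain ⟨R, hR0, hR⟩ := hS.isBounded.exists_pos_norm_le
    have hb : ∀ t ∈ Ico t0 t1, 0 < (D i).alphaX (DPTCO.mu t0 T t) := fun t ht =>
      (hD i).alphaX_class.pos (DPTCO.mu_pos (hlt t ht))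
    refine DPTCO.Design.exists_agent_bound hn (hD i) hT ht1T (htraj.continuousOn_w i)
      (htraj.continuousOn_x i) (htraj.deriv_w i) (htraj.deriv_x i) (htraj.deriv_x_last i)
      (z := zstar) (H := h R) (M := C * L₂) (L := C * L₁) (fun t ht => ?_) (fun t ht => ?_)
      (fun t ht => ?_)
    · have hmem := hd i t ⟨ht.1, hlt t ht⟩
      exact (hφ _ _ hmem).trans (mul_le_mul_of_nonneg_right
        (hmono (norm_nonneg _) hR0.le (hR _ hmem)) ((hD i).psi_pos _).le)
    · have ha := halpha.pos (DPTCO.mu_pos (hlt t ht))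
      rw [norm_neg, norm_smul, Real.norm_of_nonneg ha.le]
      have h1 := mul_le_mul_of_nonneg_left (hbound t ht i).2.2
        (mul_pos (pow_pos (hb t ht) r) ha).le
      have h2 := mul_le_mul_of_nonneg_left (hL₂ t ht) hC
      linarith
    · have h1 := mul_le_mul_of_nonneg_left (hbound t ht i).1 (pow_pos (hb t ht) (r + 1)).le
      have h2 := mul_le_mul_of_nonneg_left (hL₁ t ht) hC
      linarith
  choose Cx hCx using hagent
  refine ⟨⟨C * √(V t0) + ‖zstar‖ + ∑ i, (|Cx i| + ‖gradient (f i) zstar‖), fun t ht i => ?_⟩,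
    fun h i => ?_⟩
  · have h1 : |Cx i| + ‖gradient (f i) zstar‖ ≤ ∑ i, (|Cx i| + ‖gradient (f i) zstar‖) :=
      Finset.single_le_sum (f := fun i => |Cx i| + ‖gradient (f i) zstar‖)
        (fun i _ => by positivity) (Finset.mem_univ i)
    have h2 : C * √(V t) ≤ C * √(V t0) :=
      mul_le_mul_of_nonneg_left (Real.sqrt_le_sqrt (hVle t ht)) hC
    have h3 : 0 ≤ C * √(V t0) := by positivity
    have h4 := norm_nonneg zstar
    have h5 := norm_nonneg (gradient (f i) zstar)
    have h6 := abs_nonneg (Cx i)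
    have h7 := le_abs_self (Cx i)
    obtain ⟨hw, hp, -⟩ := hbound t ht i
    obtain ⟨hx, hu, -⟩ := hCx i t ht
    refine ⟨?_, ?_, fun q => ?_, ?_⟩
    · have := norm_le_norm_add_norm_sub' (w i t) zstar
      linarith
    · have := norm_sub_le (p i t + gradient (f i) zstar) (gradient (f i) zstar)
      rw [add_sub_cancel_right] at this
      linarith
    · linarith [hx q]
    · linarith
  · subst h
    have hα := (hD i).alphaX_class
    have htop : Tendsto (fun t => (D i).alphaX (DPTCO.mu t0 T t) ^ (r + 1)) (𝓝[<] (t0 + T)) atTop :=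
      (tendsto_pow_atTop (Nat.succ_ne_zero r)).comp (hα.tendsto_atTop.comp DPTCO.tendsto_mu)
    refine squeeze_zero' (Eventually.of_forall fun t => norm_nonneg _) ?_
      (htop.const_div_atTop (Cx i))
    filter_upwards [Ico_mem_nhdsLT ht1] with t ht
    rw [le_div_iff₀ (pow_pos (hα.pos (DPTCO.mu_pos (hlt t ht))) _), mul_comm]
    exact (hCx i t ht).2.2
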